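/- Let $\mathfrak A$ be a complex Banach algebra (not necessarily unital). For $n\ge 0$ let $\mathbf C_n(\mathfrak A)=\mathfrak A^{\widehat\otimes(n+1)}$ be the $(n+1)$-fold completed projective tensor power, and for $n\ge 1$ let $d_i\colon \mathbf C_n(\mathfrak A)\to\mathbf C_{n-1}(\mathfrak A)$, $0\le i\le n$, be the bounded linear maps determined by $$d_i(a_0\otimes\cdots\otimes a_n)=a_0\otimes\cdots\otimes a_ia_{i+1}\otimes\cdots\otimes a_n\quad(0\le i\le n-1),\qquad d_n(a_0\otimes\cdots\otimes a_n)=a_na_0\otimes a_1\otimes\cdots\otimes a_{n-1}.$$ Put $\beta=\sum_{i=0}^{n-1}(-1)^id_i$ and $\delta=\sum_{i=0}^{n}(-1)^id_i$ on $\mathbf C_n(\mathfrak A)$. The algebra $\mathfrak A$ is called strongly H-unital if for every complex Banach space $Y$ the complex $$0\longleftarrow Y\widehat\otimes\mathfrak A\xleftarrow{\,1\otimes\beta\,}Y\widehat\otimes\mathbf C_1(\mathfrak A)\xleftarrow{\,1\otimes\beta\,}Y\widehat\otimes\mathbf C_2(\mathfrak A)\longleftarrow\cdots$$ is acyclic (exact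 at every place, including $Y\widehat\otimes\mathfrak A$). The bounded Hochschild cohomology groups $\mathcal H^n(\mathfrak A,\mathfrak A^*)$, $n\ge0$, are the cohomology groups of the dual complex $$0\longrightarrow\mathbf C_0(\mathfrak A)^*\xrightarrow{\ \delta^*\ }\mathbf C_1(\mathfrak A)^*\xrightarrow{\ \delta^*\ }\mathbf C_2(\mathfrak A)^*\longrightarrow\cdots,$$ where ${}^*$ denotes the topological dual; $\mathfrak A$ is called simplicially trivial if $\mathcal H^n(\mathfrak A,\mathfrak A^*)=\{0\}$ for all $n\ge0$. **Theorem.** Let $X$ be a complex Banach space and $1\le p<\infty$. Let $\ell_p(X)$ be the Banach space of $p$-summable sequences in $X$, and let $\mathcal A(\ell_p(X))$ be the Banach algebra of approximable operators on $\ell_p(X)$, i.e. the operator-norm closure of the bounded finite rank operators. If $\mathcal A(\ell_p(X))$ is strongly H-unital, then it is simplicially trivial, that is, $$\mathcal H^n(\mathcal A(\ell_p(X)),\mathcal A(\ell_p(X))^*)=\{0\}\qquad\text{for all } n\ge 0 .$$ -/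

import Mathlib

open scoped TensorProduct ENNReal

universe u

noncomputable section

namespace SimplicialTriviality

/-! ### Projective tensor products of Banach spaces -/

section ProjectiveTensor

variable (E F G : Type*) [NormedAddCommGroup E] [NormedSpace ℂ E]
  [NormedAddCommGroup F] [NormedSpace ℂ F] [NormedAddCommGroup G] [NormedSpace ℂ G]

/-- `∑ ‖xᵢ‖ ‖yᵢ‖` for a finite list of pairs. -/
def cost {E F : Type*} [NormedAddCommGroup E] [NormedAddCommGroup F] (l : List (E × F)) : ℝ :=
  (l.map fun q => ‖q.1‖ * ‖q.2‖).sum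

lemma cost_nonneg {E F : Type*} [NormedAddCommGroup E] [NormedAddCommGroup F]
    (l : List (E × F)) : 0 ≤ cost l := by
  refine List.sum_nonneg fun a ha => ?_
  obtain ⟨q, -, rfl⟩ := List.mem_map.1 ha
  positivity

variable {E F G}

/-- The finite lists `(x₁, y₁), …, (xₘ, yₘ)` with `t = ∑ xᵢ ⊗ yᵢ`. -/
abbrev Reps (t : E ⊗[ℂ] F) : Type _ :=
  {l : List (E × F) // (l.map fun q => q.1 ⊗ₜ[ℂ] q.2).sum = t}

lemma nonempty_reps (t : E ⊗[ℂ] F) : Nonempty (Reps t) := by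
  induction t using TensorProduct.induction_on with
  | zero => exact ⟨⟨[], rfl⟩⟩
  | tmul x y => exact ⟨⟨[(x, y)], by simp⟩⟩
  | add s t hs ht =>
    obtain ⟨⟨l, hl⟩⟩ := hs
    obtain ⟨⟨m, hm⟩⟩ := ht
    exact ⟨⟨l ++ m, by rw [List.map_append, List.sum_append, hl, hm]⟩⟩

/-- The projective norm `inf {∑ ‖xᵢ‖ ‖yᵢ‖ : t = ∑ xᵢ ⊗ yᵢ}`. -/
def projNorm (t : E ⊗[ℂ] F) : ℝ := ⨅ l : Reps t, cost l.1

lemma projNorm_le {t : E ⊗[ℂ] F} (l : List (E × F))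
    (hl : (l.map fun q => q.1 ⊗ₜ[ℂ] q.2).sum = t) : projNorm t ≤ cost l :=
  ciInf_le (f := fun l : Reps t => cost l.1)
    ⟨0, by rintro _ ⟨l, rfl⟩; exact cost_nonneg _⟩ ⟨l, hl⟩

lemma projNorm_smul_le (c : ℂ) (t : E ⊗[ℂ] F) : projNorm (c • t) ≤ ‖c‖ * projNorm t := by
  have := nonempty_reps t
  rw [projNorm.eq_def t, Real.mul_iInf_of_nonneg (norm_nonneg _)]
  refine le_ciInf fun ⟨l, hl⟩ => ?_
  refine (projNorm_le (l.map fun q => (c • q.1, q.2)) ?_).trans (le_of_eq ?_)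
  · rw [← hl, List.smul_sum, List.map_map, List.map_map]
    rfl
  · simp only [cost, List.map_map, Function.comp_def, norm_smul, mul_assoc,
      List.sum_map_mul_left]

/-- The projective norm as a seminorm on the algebraic tensor product. -/
def projSeminorm : Seminorm ℂ (E ⊗[ℂ] F) :=
  Seminorm.ofSMulLE projNorm
    (le_antisymm (by simpa [cost] using projNorm_le (E := E) (F := F) [] rfl)
      (have := nonempty_reps (0 : E ⊗[ℂ] F); le_ciInf fun l => cost_nonneg l.1))
    (fun s t => by
      have := nonempty_reps s
      have := nonempty_reps t
      refine le_ciInf_add_ciInf fun l m => ?_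
      refine (projNorm_le (l.1 ++ m.1) ?_).trans (le_of_eq ?_)
      · rw [List.map_append, List.sum_append, l.2, m.2]
      · simp [cost])
    projNorm_smul_le

instance projSeminormedAddCommGroup : SeminormedAddCommGroup (E ⊗[ℂ] F) :=
  fast_instance% AddGroupSeminorm.toSeminormedAddCommGroup
    (projSeminorm (E := E) (F := F)).toAddGroupSeminorm

instance projNormedSpace : NormedSpace ℂ (E ⊗[ℂ] F) := ⟨projNorm_smul_le⟩

/-- `1 ⊗ T : E ⊗ F → E ⊗ G` for a bounded operator `T : F → G`, bounded in the projective norms. -/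
def algLmap (E : Type*) [NormedAddCommGroup E] [NormedSpace ℂ E] (T : F →L[ℂ] G) :
    E ⊗[ℂ] F →L[ℂ] E ⊗[ℂ] G :=
  LinearMap.mkContinuous (T.toLinearMap.lTensor E) ‖T‖ (fun t => by
    change projNorm _ ≤ ‖T‖ * projNorm t
    have := nonempty_reps t
    rw [projNorm.eq_def t, Real.mul_iInf_of_nonneg (norm_nonneg _)]
    refine le_ciInf fun ⟨l, hl⟩ => ?_
    refine (projNorm_le (l.map fun q => (q.1, T q.2)) ?_).trans ?_
    · rw [← hl, map_list_sum, List.map_map, List.map_map]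
      rfl
    · simp only [cost, List.map_map, Function.comp_def]
      rw [← List.sum_map_mul_left]
      refine List.sum_le_sum fun q _ => ?_
      calc ‖q.1‖ * ‖T q.2‖ ≤ ‖q.1‖ * (‖T‖ * ‖q.2‖) := by gcongr; exact T.le_opNorm _
        _ = ‖T‖ * (‖q.1‖ * ‖q.2‖) := by ring)

variable (E F) in
/-- The completed projective tensor product of two Banach spaces. -/
abbrev ProjTensor : Type _ := UniformSpace.Completion (E ⊗[ℂ] F)

/-- The bounded operator `1 ⊗ T` between completed projective tensor products. -/
def ProjTensor.lmap (E : Type*) [NormedAddCommGroup E] [NormedSpace ℂ E] (T : F →L[ℂ] G) :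
    ProjTensor E F →L[ℂ] ProjTensor E G :=
  (algLmap E T).completion

end ProjectiveTensor

/-- The subquotient `Z / B` of a module, for submodules `B ≤ Z`. -/
abbrev Subquotient {R M : Type*} [Ring R] [AddCommGroup M] [Module R M] (Z B : Submodule R M) :
    Type _ := Z ⧸ B.submoduleOf Z

/-! ### The bar complex and the Hochschild complex of a Banach algebra -/

section Complexes

variable (A : Type*) [NonUnitalNormedRing A] [NormedSpace ℂ A]
  [IsScalarTower ℂ A A] [SMulCommClass ℂ A A]

/-- The bounded `n`-chains: the completion of the `(n+1)`-fold tensor power of `A` in the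
projective norm, which is the norm that Mathlib puts on `⨂[ℂ] _, A`. -/
abbrev Chains (n : ℕ) : Type _ := UniformSpace.Completion (⨂[ℂ] _ : Fin (n + 1), A)

variable {A} in
/-- `(a₀, …, aₙ₊₁) ↦ (a₀, …, aᵢ aᵢ₊₁, …, aₙ₊₁)` for `0 ≤ i ≤ n`. -/
def innerFaceFun {n : ℕ} (i : Fin (n + 1)) (a : Fin (n + 2) → A) : Fin (n + 1) → A := fun j =>
  if j < i then a j.castSucc else if j = i then a j.castSucc * a j.succ else a j.succ

variable {A} in
/-- `(a₀, …, aₙ₊₁) ↦ (aₙ₊₁ a₀, a₁, …, aₙ)`. -/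
def lastFaceFun {n : ℕ} (a : Fin (n + 2) → A) : Fin (n + 1) → A := fun j =>
  if j = 0 then a (Fin.last (n + 1)) * a 0 else a j.castSucc

lemma innerFaceFun_update {n : ℕ} (i : Fin (n + 1)) (a : Fin (n + 2) → A) (k : Fin (n + 2)) :
    ∃ (k' : Fin (n + 1)) (L : A →ₗ[ℂ] A), ∀ x,
      innerFaceFun i (Function.update a k x) = Function.update (innerFaceFun i a) k' (L x) := by
  rcases lt_trichotomy k i.castSucc with h | h | h
  · refine ⟨⟨k, by grind⟩, LinearMap.id, fun x => ?_⟩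
    ext j
    simp only [innerFaceFun, Function.update_apply, LinearMap.id_apply]
    grind
  · refine ⟨i, LinearMap.mulRight ℂ (a i.succ), fun x => ?_⟩
    ext j
    simp only [innerFaceFun, Function.update_apply, LinearMap.mulRight_apply]
    grind
  · by_cases h' : k = i.succ
    · refine ⟨i, LinearMap.mulLeft ℂ (a i.castSucc), fun x => ?_⟩
      ext j
      simp only [innerFaceFun, Function.update_apply, LinearMap.mulLeft_apply]
      grind
    · refine ⟨k.pred (by grind), LinearMap.id, fun x => ?_⟩
      ext j
      simp only [innerFaceFun, Function.update_apply, LinearMap.id_apply]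
      grind

lemma lastFaceFun_update {n : ℕ} (a : Fin (n + 2) → A) (k : Fin (n + 2)) :
    ∃ (k' : Fin (n + 1)) (L : A →ₗ[ℂ] A), ∀ x,
      lastFaceFun (Function.update a k x) = Function.update (lastFaceFun a) k' (L x) := by
  by_cases h : k = Fin.last (n + 1)
  · refine ⟨0, LinearMap.mulRight ℂ (a 0), fun x => ?_⟩
    ext j
    simp only [lastFaceFun, Function.update_apply, LinearMap.mulRight_apply]
    grind
  · by_cases h0 : k = 0
    · refine ⟨0, LinearMap.mulLeft ℂ (a (Fin.last (n + 1))), fun x => ?_⟩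
      ext j
      simp only [lastFaceFun, Function.update_apply, LinearMap.mulLeft_apply]
      grind
    · refine ⟨⟨k, by grind⟩, LinearMap.id, fun x => ?_⟩
      ext j
      simp only [lastFaceFun, Function.update_apply, LinearMap.id_apply]
      grind

/-- `(a₀, …, aₙ₊₁) ↦ a₀ ⊗ ⋯ ⊗ aᵢ aᵢ₊₁ ⊗ ⋯ ⊗ aₙ₊₁` for `0 ≤ i ≤ n`. -/
def innerFaceMulti (n : ℕ) (i : Fin (n + 1)) :
    ContinuousMultilinearMap ℂ (fun _ : Fin (n + 2) => A) (⨂[ℂ] _ : Fin (n + 1), A) where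
  toFun a := PiTensorProduct.tprod ℂ (innerFaceFun i a)
  map_update_add' := by
    intro inst a k x y
    obtain rfl : inst = instDecidableEqFin _ := Subsingleton.elim _ _
    obtain ⟨k', L, h⟩ := innerFaceFun_update A i a k
    simp only [h, map_add, MultilinearMap.map_update_add]
  map_update_smul' := by
    intro inst a k c x
    obtain rfl : inst = instDecidableEqFin _ := Subsingleton.elim _ _
    obtain ⟨k', L, h⟩ := innerFaceFun_update A i a k
    simp only [h, map_smul, MultilinearMap.map_update_smul]
  cont := by
    refine (PiTensorProduct.tprodL ℂ (E := fun _ : Fin (n + 1) => A)).cont.comp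
      (continuous_pi fun j => ?_)
    unfold innerFaceFun
    split_ifs <;> fun_prop

/-- `(a₀, …, aₙ₊₁) ↦ aₙ₊₁ a₀ ⊗ a₁ ⊗ ⋯ ⊗ aₙ`. -/
def lastFaceMulti (n : ℕ) :
    ContinuousMultilinearMap ℂ (fun _ : Fin (n + 2) => A) (⨂[ℂ] _ : Fin (n + 1), A) where
  toFun a := PiTensorProduct.tprod ℂ (lastFaceFun a)
  map_update_add' := by
    intro inst a k x y
    obtain rfl : inst = instDecidableEqFin _ := Subsingleton.elim _ _
    obtain ⟨k', L, h⟩ := lastFaceFun_update A a k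
    simp only [h, map_add, MultilinearMap.map_update_add]
  map_update_smul' := by
    intro inst a k c x
    obtain rfl : inst = instDecidableEqFin _ := Subsingleton.elim _ _
    obtain ⟨k', L, h⟩ := lastFaceFun_update A a k
    simp only [h, map_smul, MultilinearMap.map_update_smul]
  cont := by
    refine (PiTensorProduct.tprodL ℂ (E := fun _ : Fin (n + 1) => A)).cont.comp
      (continuous_pi fun j => ?_)
    unfold lastFaceFun
    split_ifs <;> fun_prop

/-- The bounded operator on chains induced by a bounded multilinear map. -/
def liftChains (n m : ℕ)
    (f : ContinuousMultilinearMap ℂ (fun _ : Fin (n + 1) => A) (⨂[ℂ] _ : Fin (m + 1), A)) :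
    Chains A n →L[ℂ] Chains A m :=
  (PiTensorProduct.liftIsometry ℂ (fun _ : Fin (n + 1) => A) _ f).completion

/-- The face map `dᵢ`, `0 ≤ i ≤ n`, on `(n+1)`-chains. -/
def innerFace (n : ℕ) (i : Fin (n + 1)) : Chains A (n + 1) →L[ℂ] Chains A n :=
  liftChains A (n + 1) n (innerFaceMulti A n i)

/-- The face map `dₙ₊₁` on `(n+1)`-chains. -/
def lastFace (n : ℕ) : Chains A (n + 1) →L[ℂ] Chains A n :=
  liftChains A (n + 1) n (lastFaceMulti A n)

/-- The bar differential `β = ∑_{i=0}^{n} (-1)^i dᵢ` on `(n+1)`-chains. -/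
def barDiff (n : ℕ) : Chains A (n + 1) →L[ℂ] Chains A n :=
  ∑ i : Fin (n + 1), (-1 : ℂ) ^ (i : ℕ) • innerFace A n i

/-- The Hochschild differential `δ = β + (-1)^(n+1) dₙ₊₁` on `(n+1)`-chains. -/
def hochDiff (n : ℕ) : Chains A (n + 1) →L[ℂ] Chains A n :=
  barDiff A n + (-1 : ℂ) ^ (n + 1) • lastFace A n

/-- The dual map `∂ f = f ∘ δ` from bounded `n`-cochains to bounded `(n+1)`-cochains. -/
def hochCodiff (n : ℕ) : StrongDual ℂ (Chains A n) →ₗ[ℂ] StrongDual ℂ (Chains A (n + 1)) where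
  toFun f := f.comp (hochDiff A n)
  map_add' _ _ := rfl
  map_smul' _ _ := rfl

/-- The bounded Hochschild `n`-cocycles. -/
def cocycles (n : ℕ) : Submodule ℂ (StrongDual ℂ (Chains A n)) := LinearMap.ker (hochCodiff A n)

/-- The bounded Hochschild `n`-coboundaries. -/
def coboundaries : (n : ℕ) → Submodule ℂ (StrongDual ℂ (Chains A n))
  | 0 => ⊥
  | n + 1 => LinearMap.range (hochCodiff A n)

/-- The bounded Hochschild cohomology group `ℋⁿ(A, A*)`: cocycles modulo coboundaries. -/
abbrev HochCohomology (n : ℕ) : Type _ := Subquotient (cocycles A n) (coboundaries A n)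

/-- `A` is simplicially trivial if `ℋⁿ(A, A*) = 0` for all `n ≥ 0`. -/
def SimpliciallyTrivial : Prop := ∀ n : ℕ, Subsingleton (HochCohomology A n)

end Complexes

/-- `A` is strongly H-unital if its bar complex is pure exact: for every Banach space `Y` the
complex `0 ← Y ⊗̂ A ← Y ⊗̂ (A ⊗̂ A) ← ⋯` with differentials `1 ⊗ β` is acyclic. -/
def StronglyHUnital (A : Type u) [NonUnitalNormedRing A] [NormedSpace ℂ A]
    [IsScalarTower ℂ A A] [SMulCommClass ℂ A A] : Prop :=
  ∀ (Y : Type u) [NormedAddCommGroup Y] [NormedSpace ℂ Y] [CompleteSpace Y],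
    Function.Surjective (ProjTensor.lmap Y (barDiff A 0)) ∧
    ∀ n : ℕ, Function.Exact (ProjTensor.lmap Y (barDiff A (n + 1)))
      (ProjTensor.lmap Y (barDiff A n))

/-! ### Approximable operators -/

section Approximable

variable (E : Type*) [NormedAddCommGroup E] [NormedSpace ℂ E]

/-- The algebra of bounded operators of finite rank on `E`. -/
def finiteRank : NonUnitalSubalgebra ℂ (E →L[ℂ] E) where
  carrier := {T | FiniteDimensional ℂ (LinearMap.range T.toLinearMap)}
  zero_mem' := by
    change FiniteDimensional ℂ (LinearMap.range (0 : E →ₗ[ℂ] E))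
    rw [LinearMap.range_zero]
    infer_instance
  add_mem' := by
    intro S T hS hT
    have : FiniteDimensional ℂ (LinearMap.range S.toLinearMap) := hS
    have : FiniteDimensional ℂ (LinearMap.range T.toLinearMap) := hT
    exact Submodule.finiteDimensional_of_le
      (LinearMap.range_add_le S.toLinearMap T.toLinearMap)
  mul_mem' := by
    intro S T hS _
    have : FiniteDimensional ℂ (LinearMap.range S.toLinearMap) := hS
    exact Submodule.finiteDimensional_of_le
      (LinearMap.range_comp_le_range T.toLinearMap S.toLinearMap)
  smul_mem' := by
    intro c T hT
    have : FiniteDimensional ℂ (LinearMap.range T.toLinearMap) := hT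
    refine Submodule.finiteDimensional_of_le (S₂ := LinearMap.range T.toLinearMap) ?_
    rintro _ ⟨x, rfl⟩
    exact Submodule.smul_mem _ c ⟨x, rfl⟩

/-- The Banach algebra of approximable operators on `E`: the norm closure of the finite rank
operators in the bounded operators. -/
def approximable : NonUnitalSubalgebra ℂ (E →L[ℂ] E) := (finiteRank E).topologicalClosure

instance : NormedSpace ℂ (approximable E) :=
  inferInstanceAs (NormedSpace ℂ (approximable E).toSubmodule)

end Approximable

end SimplicialTriviality

end

/-! Write E for ℓ_p(X) and A for the approximable operators on E. The argument has two halves: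
cocycles on A are enlarged to a unital algebra containing A as an ideal, and there they are killed
by amplification.

Excision. The enlarged algebra W consists of the pairs (S, T) of bounded operators on E with S - T
in A. It contains A as the ideal of pairs (a, 0), complemented by (S, T) ↦ S - T; this avoids asking
that A be complemented in B(E). A cocycle on A is first extended by composing with the projection,
so that its coboundary vanishes when all entries lie in A. The entries 1, 2, … are then released
from A, the last one first. Each release is obstructed by a family of bar cocycles on A,
parametrised multilinearly by the free entries. Purity of the bar complex provides a bounded linear
lift of all bar cocycles at once (`exists_lift_multilinear`), hence a correction of the cochain that
does not change it on A. The outcome, `ComplementedIdeal.exists_extension`, is a cocycle F on W with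
coefficients in A*.

Amplification. Cutting E into countably many copies of itself gives S_k, R_k with R_k S_l = δ_kl,
and Φ_N(w) = ∑_{k<N} S_k w R_k is a contractive homomorphism. Since Φ_N(w) S_k = S_k w and R_k
Φ_N(w) = w R_k, inserting S_k is a simplicial homotopy. Summed over k < N it gives N F - F ∘ Φ_N = δ
g_N with ‖g_N‖ = O(N) (`Amplifier.exists_homotopy`). As F ∘ Φ_N stays bounded, dividing by N and
taking a limit along an ultrafilter gives F = δ G. In degree zero F is a trace, so F ∘ Φ_N = N F is
bounded in N and F = 0. -/

noncomputable section

namespace SimplicialTriviality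

set_option linter.unusedSectionVars false

/-! ### Faces, cochains and homotopies on functions of several variables -/

section Combinatorics

variable {M : Type*} [AddCommGroup M] [Module ℂ M]

/-- The combinatorics of δ² = 0: the hypothesis matches each term with i < j to one with i ≥ j of
opposite sign. The induction peels off the last row and the last column, which cancel. -/
lemma sum_alternating_eq_zero (a : ℕ → ℕ → M) (m : ℕ)
    (h : ∀ i j, i ≤ j → j < m → a i (j + 1) = a j i) :
    ∑ j ∈ Finset.range (m + 1), (-1 : ℂ) ^ j • ∑ i ∈ Finset.range m, (-1 : ℂ) ^ i • a i j = 0 := by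
  induction m with
  | zero => simp
  | succ m ih =>
    have ih := ih fun i j hij hj => h i j hij (by omega)
    have hrow : ∀ j, ∑ i ∈ Finset.range (m + 1), (-1 : ℂ) ^ i • a i j =
        (∑ i ∈ Finset.range m, (-1 : ℂ) ^ i • a i j) + (-1 : ℂ) ^ m • a m j := fun j =>
      Finset.sum_range_succ _ _
    simp only [hrow, smul_add, Finset.sum_add_distrib]
    rw [Finset.sum_range_succ, ih, zero_add]
    have h1 : ∑ i ∈ Finset.range m, (-1 : ℂ) ^ i • a i (m + 1) =
        ∑ i ∈ Finset.range m, (-1 : ℂ) ^ i • a m i := by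
      refine Finset.sum_congr rfl fun i hi => ?_
      rw [h i m (Finset.mem_range.1 hi).le (by omega)]
    rw [h1, Finset.sum_range_succ, Finset.sum_range_succ, h m m le_rfl (by omega)]
    have h2 : ∑ x ∈ Finset.range m, (-1 : ℂ) ^ x • (-1 : ℂ) ^ m • a m x =
        (-1 : ℂ) ^ m • ∑ i ∈ Finset.range m, (-1 : ℂ) ^ i • a m i := by
      rw [Finset.smul_sum]
      exact Finset.sum_congr rfl fun i _ => smul_comm _ _ _
    rw [h2, pow_succ]
    module

/-- The identities of a simplicial homotopy h, with `b i j` for f(dᵢ hⱼ x) and `c i j` for f(hⱼ dᵢ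
x). Off-diagonal terms become the terms of `c` with sign reversed, and the diagonal ones telescope,
leaving the two ends. -/
lemma sum_homotopy (b c : ℕ → ℕ → M) (n : ℕ)
    (hlt : ∀ i j, i ≤ j → j < n → b i (j + 1) = c i j)
    (hgt : ∀ i j, j < i → i ≤ n → b (i + 1) j = c i j)
    (hdiag : ∀ j, j < n → b (j + 1) (j + 1) = b (j + 1) j) :
    ∑ j ∈ Finset.range (n + 1), (-1 : ℂ) ^ j • ∑ i ∈ Finset.range (n + 2), (-1 : ℂ) ^ i • b i j =
      b 0 0 - b (n + 1) n -
        ∑ i ∈ Finset.range (n + 1), (-1 : ℂ) ^ i • ∑ j ∈ Finset.range n, (-1 : ℂ) ^ j • c i j := by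
  induction n with
  | zero => simp [Finset.sum_range_succ, sub_eq_add_neg]
  | succ n ih =>
    have ih := ih (fun i j h h' => hlt i j h (by omega)) (fun i j h h' => hgt i j h (by omega))
      (fun j h => hdiag j (by omega))
    have hb : ∀ j, ∑ i ∈ Finset.range (n + 1 + 2), (-1 : ℂ) ^ i • b i j =
        (∑ i ∈ Finset.range (n + 2), (-1 : ℂ) ^ i • b i j) + (-1 : ℂ) ^ (n + 2) • b (n + 2) j :=
      fun j => Finset.sum_range_succ _ _
    have hc : ∀ i, ∑ j ∈ Finset.range (n + 1), (-1 : ℂ) ^ j • c i j =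
        (∑ j ∈ Finset.range n, (-1 : ℂ) ^ j • c i j) + (-1 : ℂ) ^ n • c i n :=
      fun j => Finset.sum_range_succ _ _
    have hrow : ∑ j ∈ Finset.range (n + 1), (-1 : ℂ) ^ j • (-1 : ℂ) ^ (n + 2) • b (n + 2) j =
        (-1 : ℂ) ^ n • ((∑ j ∈ Finset.range n, (-1 : ℂ) ^ j • c (n + 1) j) +
          (-1 : ℂ) ^ n • c (n + 1) n) := by
      rw [← hc, Finset.smul_sum]
      refine Finset.sum_congr rfl fun j hj => ?_
      rw [hgt (n + 1) j (Finset.mem_range.1 hj) le_rfl, pow_add, smul_comm]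
      simp
    have hcol : ∑ i ∈ Finset.range (n + 1), (-1 : ℂ) ^ i • b i (n + 1) =
        ∑ i ∈ Finset.range (n + 1), (-1 : ℂ) ^ i • c i n := by
      refine Finset.sum_congr rfl fun i hi => ?_
      rw [hlt i n (Nat.lt_succ_iff.1 (Finset.mem_range.1 hi)) (by omega)]
    have hcol' : ∑ i ∈ Finset.range (n + 1), (-1 : ℂ) ^ i • (-1 : ℂ) ^ n • c i n =
        (-1 : ℂ) ^ n • ∑ i ∈ Finset.range (n + 1), (-1 : ℂ) ^ i • c i n := by
      rw [Finset.smul_sum]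
      exact Finset.sum_congr rfl fun i _ => smul_comm _ _ _
    simp only [hb, hc, smul_add, Finset.sum_add_distrib]
    rw [Finset.sum_range_succ _ (n + 1), ih, Finset.sum_range_succ _ (n + 1), hcol,
      Finset.sum_range_succ _ (n + 1), hrow, Finset.sum_range_succ _ (n + 1),
      Finset.sum_range_succ _ (n + 1), hdiag n (by omega), hcol']
    have e : (-1 : ℂ) ^ n * (-1 : ℂ) ^ n = 1 := by rw [← mul_pow]; simp
    simp only [smul_smul, smul_add, pow_succ, mul_neg, mul_one, neg_mul, neg_neg, e, one_smul,
      neg_smul, smul_neg]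
    abel

end Combinatorics

/-! ### Simplicial identities for faces and for the insertion of an element. -/

section Faces

variable {W : Type*} [NonUnitalNormedRing W]

/-- The face map `dᵢ` on `(n+2)`-tuples, for all `0 ≤ i ≤ n + 1`. -/
def face {n : ℕ} (i : ℕ) (x : Fin (n + 2) → W) : Fin (n + 1) → W :=
  if h : i < n + 1 then innerFaceFun ⟨i, h⟩ x else lastFaceFun x

lemma face_apply_of_lt {n i : ℕ} (x : Fin (n + 2) → W) (hi : i < n + 1) (j : Fin (n + 1))
    (h : (j : ℕ) < i) : face i x j = x j.castSucc := by
  simp [face, hi, innerFaceFun, Fin.lt_def, h]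

lemma face_apply_of_eq {n i : ℕ} (x : Fin (n + 2) → W) (j : Fin (n + 1))
    (h : (j : ℕ) = i) : face i x j = x j.castSucc * x j.succ := by
  subst h
  rw [face, dif_pos j.2]
  simp [innerFaceFun]

lemma face_last_zero {n i : ℕ} (x : Fin (n + 2) → W) (hi : n < i) :
    face i x 0 = x (Fin.last (n + 1)) * x 0 := by
  have : ¬ i < n + 1 := by omega
  simp [face, this, lastFaceFun]

lemma face_last_of_ne_zero {n i : ℕ} (x : Fin (n + 2) → W) (hi : n < i) (j : Fin (n + 1))
    (hj : j ≠ 0) : face i x j = x j.castSucc := by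
  have : ¬ i < n + 1 := by omega
  simp [face, this, lastFaceFun, hj]

/-- Indexing tuples by ℕ turns the face identities into case distinctions in linear arithmetic. The
values 0 out of range never matter. -/
lemma exists_nat_extension {V : Type*} [Zero V] {n : ℕ} (x : Fin n → V) :
    ∃ y : ℕ → V, ∀ i, x i = y i :=
  ⟨fun k => if h : k < n then x ⟨k, h⟩ else 0, fun i => by simp⟩

lemma face_face {n i j : ℕ} (hij : i ≤ j) (hj : j < n + 2) (x : Fin (n + 3) → W) :
    face i (face (j + 1) x) = face j (face i x) := by
  ext l
  have hl := l.2
  obtain ⟨y, hy⟩ := exists_nat_extension x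
  simp only [face]
  by_cases h1 : i < n + 1 <;> by_cases h2 : j + 1 < n + 1 + 1 <;> by_cases h3 : j < n + 1 <;>
    by_cases h4 : i < n + 1 + 1 <;>
    first | omega | skip
  all_goals simp only [h1, h2, h3, h4, dif_pos, dif_neg, not_false_eq_true]
  all_goals simp only [innerFaceFun, lastFaceFun, Fin.lt_def, Fin.ext_iff, hy,
    Fin.val_castSucc, Fin.val_succ, Fin.val_last, Fin.val_zero]
  all_goals grind [mul_assoc]

/-- The Hochschild coboundary of a function of `n + 1` variables. -/
def coface {n : ℕ} (f : (Fin (n + 1) → W) → ℂ) (x : Fin (n + 2) → W) : ℂ :=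
  ∑ i ∈ Finset.range (n + 2), (-1 : ℂ) ^ i • f (face i x)

lemma coface_coface {n : ℕ} (f : (Fin (n + 1) → W) → ℂ) (x : Fin (n + 3) → W) :
    coface (coface f) x = 0 :=
  sum_alternating_eq_zero (fun i j => f (face i (face j x))) (n + 2) fun i j hij hj => by
    rw [face_face hij hj]

/-- The tuple `(P x₀, α x₁, …, α xⱼ, U, γ xⱼ₊₁, …, γ xₙ)`. -/
def insertAt (P α γ : W → W) (U : W) {n : ℕ} (j : ℕ) (x : Fin (n + 1) → W) : Fin (n + 2) → W :=
  fun l => if l = 0 then P (x 0) else if h : (l : ℕ) ≤ j ∧ (l : ℕ) < n + 1 then α (x ⟨l, h.2⟩) else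
    if (l : ℕ) = j + 1 then U else γ (x ⟨l - 1, by omega⟩)

/-- The face acts to the left of U, where multiplicativity of α applies; for i = 0 the entry P x₀
absorbs its right neighbour through `hP`. -/
lemma face_insertAt_of_le {P α γ : W → W} {U : W} {I : Set W}
    (hP : ∀ m ∈ I, ∀ b, P (m * b) = P m * α b) (hα : ∀ a b, α (a * b) = α a * α b)
    {n i j : ℕ} (x : Fin (n + 2) → W) (hx : x 0 ∈ I) (hij : i ≤ j) (hj : j < n + 1) :
    face i (insertAt P α γ U (j + 1) x) = insertAt P α γ U j (face i x) := by
  ext l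
  have hl := l.2
  obtain ⟨y, hy⟩ := exists_nat_extension x
  rw [hy] at hx
  simp only [Fin.val_zero] at hx
  have h1 : i < n + 1 := by omega
  have h2 : i < n + 1 + 1 := by omega
  simp only [face, h1, h2, dif_pos]
  simp only [innerFaceFun, insertAt, Fin.lt_def, Fin.ext_iff, hy,
    Fin.val_castSucc, Fin.val_succ, Fin.val_zero]
  grind [mul_assoc]

/-- The face acts to the right of U, through γ; the cyclic face multiplies P x₀ on the left, whence
the left-handed form of `hP`. -/
lemma face_insertAt_of_gt {P α γ : W → W} {U : W} {I : Set W}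
    (hP : ∀ m ∈ I, ∀ b, P (b * m) = γ b * P m) (hγ : ∀ a b, γ (a * b) = γ a * γ b)
    {n i j : ℕ} (x : Fin (n + 2) → W) (hx : x 0 ∈ I) (hij : j < i) (hi : i ≤ n + 1) :
    face (i + 1) (insertAt P α γ U j x) = insertAt P α γ U j (face i x) := by
  ext l
  have hl := l.2
  obtain ⟨y, hy⟩ := exists_nat_extension x
  rw [hy] at hx
  simp only [Fin.val_zero] at hx
  by_cases h1 : i < n + 1
  · have h2 : i + 1 < n + 1 + 1 := by omega
    simp only [face, h1, h2, dif_pos]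
    simp only [innerFaceFun, insertAt, Fin.lt_def, Fin.ext_iff, hy,
      Fin.val_castSucc, Fin.val_succ, Fin.val_zero]
    grind [mul_assoc]
  · have h2 : ¬ i + 1 < n + 1 + 1 := by omega
    simp only [face, h1, h2, dif_neg, not_false_eq_true]
    simp only [lastFaceFun, insertAt, Fin.ext_iff, hy,
      Fin.val_castSucc, Fin.val_last, Fin.val_zero]
    grind [mul_assoc]

/-- One side merges α xⱼ₊₁ into U from the left, the other merges γ xⱼ₊₁ into U from the right. -/
lemma face_insertAt_diag {P α γ : W → W} {U : W} (hU : ∀ b, α b * U = U * γ b)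
    {n j : ℕ} (x : Fin (n + 1) → W) (hj : j < n) :
    face (j + 1) (insertAt P α γ U (j + 1) x) = face (j + 1) (insertAt P α γ U j x) := by
  ext l
  have hl := l.2
  obtain ⟨y, hy⟩ := exists_nat_extension x
  have h1 : j + 1 < n + 1 := by omega
  simp only [face, h1, dif_pos]
  simp only [innerFaceFun, insertAt, Fin.lt_def, Fin.ext_iff, hy,
    Fin.val_castSucc, Fin.val_succ, Fin.val_zero]
  grind

lemma face_zero_insertAt_zero {P α γ : W → W} {U : W} {n : ℕ} (x : Fin (n + 1) → W) :
    face 0 (insertAt P α γ U 0 x) = fun l => if l = 0 then P (x 0) * U else γ (x l) := by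
  ext l
  have hl := l.2
  obtain ⟨y, hy⟩ := exists_nat_extension x
  have h1 : 0 < n + 1 := by omega
  simp only [face, h1, dif_pos]
  simp only [innerFaceFun, insertAt, Fin.lt_def, Fin.ext_iff, hy,
    Fin.val_castSucc, Fin.val_succ, Fin.val_zero]
  grind

lemma face_last_insertAt_last {P α γ : W → W} {U : W} {n : ℕ} (x : Fin (n + 1) → W) :
    face (n + 1) (insertAt P α γ U n x) = fun l => if l = 0 then U * P (x 0) else α (x l) := by
  ext l
  have hl := l.2
  obtain ⟨y, hy⟩ := exists_nat_extension x
  have h1 : ¬ n + 1 < n + 1 := by omega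
  simp only [face, h1, dif_neg, not_false_eq_true]
  simp only [lastFaceFun, insertAt, Fin.ext_iff, hy,
    Fin.val_castSucc, Fin.val_last, Fin.val_zero]
  grind

/-- The chain homotopy between the two transports of a cocycle `f` along an intertwiner. -/
lemma sum_insertAt_face {P α γ : W → W} {U : W} {I : Set W}
    (hPα : ∀ m ∈ I, ∀ b, P (m * b) = P m * α b) (hPγ : ∀ m ∈ I, ∀ b, P (b * m) = γ b * P m)
    (hα : ∀ a b, α (a * b) = α a * α b) (hγ : ∀ a b, γ (a * b) = γ a * γ b)
    (hU : ∀ b, α b * U = U * γ b) (hPI : ∀ m ∈ I, P m ∈ I)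
    {n : ℕ} (f : (Fin (n + 2) → W) → ℂ) (hf : ∀ x, x 0 ∈ I → coface f x = 0)
    (x : Fin (n + 2) → W) (hx : x 0 ∈ I) :
    coface (fun y => ∑ j ∈ Finset.range (n + 1), (-1 : ℂ) ^ j • f (insertAt P α γ U j y)) x =
      f (fun l => if l = 0 then P (x 0) * U else γ (x l)) -
        f (fun l => if l = 0 then U * P (x 0) else α (x l)) := by
  have key := sum_homotopy (fun i j => f (face i (insertAt P α γ U j x)))
    (fun i j => f (insertAt P α γ U j (face i x))) (n + 1)
    (fun i j hij hj => by rw [face_insertAt_of_le hPα hα x hx hij hj])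
    (fun i j hij hi => by rw [face_insertAt_of_gt hPγ hγ x hx hij hi])
    (fun j hj => by rw [face_insertAt_diag hU x hj])
  rw [face_zero_insertAt_zero, face_last_insertAt_last] at key
  -- The inserted tuples still begin with an element of I, namely P x₀, so the cocycle identity
  -- applies to each.
  have h0 : ∑ j ∈ Finset.range (n + 1 + 1), (-1 : ℂ) ^ j • ∑ i ∈ Finset.range (n + 1 + 2),
      (-1 : ℂ) ^ i • f (face i (insertAt P α γ U j x)) = 0 :=
    Finset.sum_eq_zero fun j _ => by
      rw [show ∑ i ∈ Finset.range (n + 1 + 2), (-1 : ℂ) ^ i • f (face i (insertAt P α γ U j x)) =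
        coface f (insertAt P α γ U j x) from rfl, hf _ (by simpa [insertAt] using hPI _ hx),
        smul_zero]
  rw [h0] at key
  exact (sub_eq_zero.1 key.symm).symm

/-- Degree-zero cocycles are traces: the coboundary on the pair (P m, U) is a commutator. -/
lemma apply_eq_of_coface_eq_zero {P : W → W} {U : W} {I : Set W} (hPI : ∀ m ∈ I, P m ∈ I)
    (f : (Fin 1 → W) → ℂ) (hf : ∀ x, x 0 ∈ I → coface f x = 0) (m : W) (hm : m ∈ I) :
    f (fun _ => P m * U) = f (fun _ => U * P m) := by
  have h := hf ![P m, U] (hPI m hm)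
  have h0 : face 0 ![P m, U] = fun _ => P m * U := by
    ext l; obtain rfl : l = 0 := (by omega); simp [face, innerFaceFun]
  have h1 : face 1 ![P m, U] = fun _ => U * P m := by
    ext l; obtain rfl : l = 0 := (by omega); simp [face, lastFaceFun]
  simp only [coface, Finset.sum_range_succ, Finset.sum_range_zero, zero_add, pow_zero, one_smul,
    h0, h1, pow_one, neg_smul] at h
  exact sub_eq_zero.1 (by rw [sub_eq_add_neg]; exact h)

end Faces

/-! ### Duals of chain spaces and splittings of the dual bar complex -/

section Duality

lemma exists_completion_extension {V G : Type*} [SeminormedAddCommGroup V] [NormedSpace ℂ V]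
    [NormedAddCommGroup G] [NormedSpace ℂ G] [CompleteSpace G] (f : V →L[ℂ] G) :
    ∃ g : UniformSpace.Completion V →L[ℂ] G, ∀ v : V, g (v : UniformSpace.Completion V) = f v :=
  ⟨f.extend UniformSpace.Completion.toComplL, fun v =>
    f.extend_eq (e := UniformSpace.Completion.toComplL) UniformSpace.Completion.denseRange_coe
      (UniformSpace.Completion.isUniformInducing_coe V) v⟩

lemma completion_ext {V G : Type*} [SeminormedAddCommGroup V] [NormedSpace ℂ V]
    [NormedAddCommGroup G] [NormedSpace ℂ G] {f g : UniformSpace.Completion V →L[ℂ] G}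
    (h : ∀ v : V, f (v : UniformSpace.Completion V) = g (v : UniformSpace.Completion V)) :
    f = g :=
  DFunLike.ext' <| UniformSpace.Completion.denseRange_coe.equalizer f.continuous g.continuous
    (funext h)

variable (A : Type*) [NonUnitalNormedRing A] [NormedSpace ℂ A]
  [IsScalarTower ℂ A A] [SMulCommClass ℂ A A]

/-- Bounded multilinear functionals in `n + 1` variables. -/
abbrev Cochain (W : Type*) [NormedAddCommGroup W] [NormedSpace ℂ W] (n : ℕ) : Type _ :=
  ContinuousMultilinearMap ℂ (fun _ : Fin (n + 1) => W) ℂ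

variable {A} in
/-- An elementary tensor, as a chain. -/
def pureChain {n : ℕ} (a : Fin (n + 1) → A) : Chains A n :=
  ((PiTensorProduct.tprod ℂ a : ⨂[ℂ] _ : Fin (n + 1), A) : Chains A n)

/-- The multilinear functional attached to a bounded functional on chains. -/
def ofDual (n : ℕ) : StrongDual ℂ (Chains A n) →L[ℂ] Cochain A n :=
  ((PiTensorProduct.liftIsometry ℂ (fun _ : Fin (n + 1) => A) ℂ).symm :
      ((⨂[ℂ] _ : Fin (n + 1), A) →L[ℂ] ℂ) →L[ℂ] Cochain A n).comp
    (ContinuousLinearMap.precomp ℂ (UniformSpace.Completion.toComplL))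

lemma ofDual_apply {n : ℕ} (f : StrongDual ℂ (Chains A n)) (a : Fin (n + 1) → A) :
    ofDual A n f a = f (pureChain a) := by
  have h := PiTensorProduct.liftIsometry_apply_apply (𝕜 := ℂ)
    (ofDual A n f) (PiTensorProduct.tprod ℂ a)
  rw [PiTensorProduct.lift.tprod] at h
  refine h.symm.trans ?_
  simp [ofDual, pureChain]

lemma dual_ext {n : ℕ} {V : Type*} [NormedAddCommGroup V] [NormedSpace ℂ V]
    {f g : Chains A n →L[ℂ] V} (h : ∀ a, f (pureChain a) = g (pureChain a)) : f = g := by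
  refine completion_ext fun v => ?_
  have : (f.comp UniformSpace.Completion.toComplL).toLinearMap =
      (g.comp UniformSpace.Completion.toComplL).toLinearMap :=
    PiTensorProduct.ext (MultilinearMap.ext h)
  exact LinearMap.congr_fun this v

lemma ofDual_bijective (n : ℕ) : Function.Bijective (ofDual A n) := by
  refine ⟨fun f g h => dual_ext A fun a => ?_, fun F => ?_⟩
  · rw [← ofDual_apply, ← ofDual_apply, h]
  · obtain ⟨g, hg⟩ := exists_completion_extension
      (PiTensorProduct.liftIsometry ℂ (fun _ : Fin (n + 1) => A) ℂ F)
    refine ⟨g, ContinuousMultilinearMap.ext fun a => ?_⟩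
    rw [ofDual_apply, pureChain, hg, PiTensorProduct.liftIsometry_apply_apply,
      PiTensorProduct.lift.tprod]
    rfl

/-- Bounded functionals on chains are the bounded multilinear functionals. -/
def dualEquiv (n : ℕ) : StrongDual ℂ (Chains A n) ≃L[ℂ] Cochain A n :=
  ContinuousLinearEquiv.ofBijective (𝕜 := ℂ) (𝕜' := ℂ) (σ := RingHom.id ℂ) (E := StrongDual ℂ (Chains A n)) (F := Cochain A n)
    (ofDual A n)
    (LinearMap.ker_eq_bot.2 (ofDual_bijective A n).1)
    (LinearMap.range_eq_top.2 (ofDual_bijective A n).2)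

lemma dualEquiv_apply {n : ℕ} (f : StrongDual ℂ (Chains A n)) (a : Fin (n + 1) → A) :
    dualEquiv A n f a = f (pureChain a) := ofDual_apply A f a

lemma dualEquiv_symm_pureChain {n : ℕ} (F : Cochain A n) (a : Fin (n + 1) → A) :
    (dualEquiv A n).symm F (pureChain a) = F a := by
  rw [← dualEquiv_apply, ContinuousLinearEquiv.apply_symm_apply]

lemma liftChains_pureChain {n m : ℕ}
    (f : ContinuousMultilinearMap ℂ (fun _ : Fin (n + 1) => A) (⨂[ℂ] _ : Fin (m + 1), A))
    (a : Fin (n + 1) → A) : liftChains A n m f (pureChain a) = (f a : Chains A m) := by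
  rw [liftChains, pureChain, ContinuousLinearMap.coe_completion]
  rw [UniformSpace.Completion.map_coe (ContinuousLinearMap.uniformContinuous _),
    PiTensorProduct.liftIsometry_apply_apply, PiTensorProduct.lift.tprod]
  rfl

lemma innerFace_pureChain {n : ℕ} (i : Fin (n + 1)) (a : Fin (n + 2) → A) :
    innerFace A n i (pureChain a) = pureChain (face i a) := by
  rw [innerFace, liftChains_pureChain, face, dif_pos i.2]
  rfl

lemma lastFace_pureChain {n : ℕ} (a : Fin (n + 2) → A) :
    lastFace A n (pureChain a) = pureChain (face (n + 1) a) := by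
  rw [lastFace, liftChains_pureChain, face, dif_neg (lt_irrefl _)]
  rfl

lemma barDiff_pureChain {n : ℕ} (a : Fin (n + 2) → A) :
    barDiff A n (pureChain a) =
      ∑ i ∈ Finset.range (n + 1), (-1 : ℂ) ^ i • pureChain (face i a) := by
  rw [barDiff, sum_apply, Finset.sum_range]
  simp [innerFace_pureChain]

lemma hochDiff_pureChain {n : ℕ} (a : Fin (n + 2) → A) :
    hochDiff A n (pureChain a) =
      ∑ i ∈ Finset.range (n + 2), (-1 : ℂ) ^ i • pureChain (face i a) := by
  rw [hochDiff, Finset.sum_range_succ, ← barDiff_pureChain, ← lastFace_pureChain]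
  rfl

end Duality

/-! ### Bounded linear lifts from purity of exact sequences. -/

section Splitting

variable {E F G : Type*} [NormedAddCommGroup E] [NormedSpace ℂ E]
  [NormedAddCommGroup F] [NormedSpace ℂ F] [NormedAddCommGroup G] [NormedSpace ℂ G]

/-- A functional vanishing on the kernel of an operator with closed range factors through it. -/
lemma exists_factor_of_isClosed_range [CompleteSpace E] [CompleteSpace F] (T : E →L[ℂ] F)
    (hT : IsClosed (Set.range T)) (f : StrongDual ℂ E) (hf : ∀ x, T x = 0 → f x = 0) :
    ∃ g : StrongDual ℂ F, ∀ x, g (T x) = f x := by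
  let K : Submodule ℂ F := LinearMap.range T.toLinearMap
  have hK : IsClosed (K : Set F) := hT
  have : CompleteSpace K := hK.completeSpace_coe
  let T' : E →L[ℂ] K := T.codRestrict K fun x => ⟨x, rfl⟩
  have hT' : Function.Surjective T' := by
    rintro ⟨_, x, rfl⟩
    exact ⟨x, rfl⟩
  -- Open mapping theorem onto the closed range. The chosen preimages `s` need not be linear in `y`,
  -- but `f ∘ s` is, since `f` is constant on the fibres of `T`.
  obtain ⟨C, hC, hpre⟩ := T'.exists_preimage_norm_le hT'
  choose s hs hsn using hpre
  have hTs : ∀ y, T (s y) = y := fun y => congrArg Subtype.val (hs y)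
  have hfs : ∀ (x : E) (y : K), T x = y → f x = f (s y) := fun x y hxy => by
    rw [← sub_eq_zero, ← map_sub]
    exact hf _ (by rw [map_sub, hTs, hxy, sub_self])
  let g₀ : K →ₗ[ℂ] ℂ :=
    { toFun := fun y => f (s y)
      map_add' := fun y z => by
        rw [← map_add]
        exact (hfs _ _ (by rw [map_add, hTs, hTs]; rfl)).symm
      map_smul' := fun c y => by
        rw [RingHom.id_apply, ← map_smul]
        exact (hfs _ _ (by rw [map_smul, hTs]; rfl)).symm }
  let g₁ : StrongDual ℂ K := g₀.mkContinuous (‖f‖ * C) fun y => by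
    calc ‖f (s y)‖ ≤ ‖f‖ * ‖s y‖ := f.le_opNorm _
      _ ≤ ‖f‖ * (C * ‖y‖) := by gcongr; exact hsn y
      _ = ‖f‖ * C * ‖y‖ := by ring
  obtain ⟨g, hg, -⟩ := exists_extension_norm_eq K g₁
  exact ⟨g, fun x => (hg ⟨T x, x, rfl⟩).trans (hfs x ⟨T x, x, rfl⟩ rfl).symm⟩

/-- An elementary tensor in the completed projective tensor product. -/
def pureTensor (x : E) (y : F) : ProjTensor E F := ((x ⊗ₜ[ℂ] y : E ⊗[ℂ] F) : ProjTensor E F)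

lemma lmap_pureTensor (T : F →L[ℂ] G) (x : E) (y : F) :
    ProjTensor.lmap E T (pureTensor x y) = pureTensor x (T y) := by
  rw [ProjTensor.lmap, pureTensor, ContinuousLinearMap.coe_completion,
    UniformSpace.Completion.map_coe (ContinuousLinearMap.uniformContinuous _)]
  rfl

lemma norm_pureTensor_le (x : E) (y : F) : ‖pureTensor x y‖ ≤ ‖x‖ * ‖y‖ := by
  rw [pureTensor, UniformSpace.Completion.norm_coe]
  exact (projNorm_le [(x, y)] (by simp)).trans (by simp [cost])

/-- The bounded bilinear map `(x, y) ↦ x ⊗ y`. -/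
def pureTensorL : E →L[ℂ] F →L[ℂ] ProjTensor E F :=
  LinearMap.mkContinuous₂ ((TensorProduct.mk ℂ E F).compr₂
    (UniformSpace.Completion.toComplL : E ⊗[ℂ] F →L[ℂ] ProjTensor E F).toLinearMap) 1
    fun x y => (norm_pureTensor_le x y).trans (by rw [one_mul])

lemma exists_tensor_functional (B : E →L[ℂ] StrongDual ℂ F) :
    ∃ g : StrongDual ℂ (ProjTensor E F), ∀ x y, g (pureTensor x y) = B x y := by
  let b : E →ₗ[ℂ] F →ₗ[ℂ] ℂ := LinearMap.mk₂ ℂ (fun x y => B x y) (by simp) (by simp) (by simp)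
    (by simp)
  let f : E ⊗[ℂ] F →L[ℂ] ℂ := LinearMap.mkContinuous (TensorProduct.lift b) ‖B‖ fun t => by
    change _ ≤ ‖B‖ * projNorm t
    have := nonempty_reps t
    rw [projNorm, Real.mul_iInf_of_nonneg (norm_nonneg B)]
    refine le_ciInf fun ⟨l, hl⟩ => ?_
    change _ ≤ ‖B‖ * cost l
    rw [← hl, map_list_sum, List.map_map, cost, ← List.sum_map_mul_left]
    refine (List.le_sum_of_subadditive norm norm_zero.le norm_add_le _).trans ?_
    rw [List.map_map]
    refine List.sum_le_sum fun q _ => ?_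
    rw [← mul_assoc]
    exact B.le_opNorm₂ q.1 q.2
  obtain ⟨g, hg⟩ := exists_completion_extension f
  exact ⟨g, fun x y => hg _⟩

lemma projTensor_ext {f g : ProjTensor E F →L[ℂ] G}
    (h : ∀ x y, f (pureTensor x y) = g (pureTensor x y)) : f = g := by
  refine completion_ext fun v => ?_
  have : (f.comp UniformSpace.Completion.toComplL).toLinearMap =
      (g.comp UniformSpace.Completion.toComplL).toLinearMap := TensorProduct.ext' h
  exact LinearMap.congr_fun this v

/-- A bounded multilinear family of functionals vanishing on the range of `d₁` lifts along the
dual of `d₀`, if the sequence `(d₁, d₀)` stays exact, with `d₀` of closed range, under all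
projective tensor products. -/
lemma exists_lift_multilinear {C₀ : Type*} {C₁ C₂ : Type u} [NormedAddCommGroup C₀]
    [NormedSpace ℂ C₀] [NormedAddCommGroup C₁] [NormedSpace ℂ C₁] [NormedAddCommGroup C₂]
    [NormedSpace ℂ C₂] (d₁ : C₂ →L[ℂ] C₁) (d₀ : C₁ →L[ℂ] C₀)
    (h : ∀ (Y : Type u) [NormedAddCommGroup Y] [NormedSpace ℂ Y] [CompleteSpace Y],
      IsClosed (Set.range (ProjTensor.lmap Y d₀)) ∧
        Function.Exact (ProjTensor.lmap Y d₁) (ProjTensor.lmap Y d₀))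
    {ι : Type*} [Finite ι] (Ω : ContinuousMultilinearMap ℂ (fun _ : ι => E) (StrongDual ℂ C₁))
    (hΩ : ∀ v c, Ω v (d₁ c) = 0) :
    ∃ Γ : ContinuousMultilinearMap ℂ (fun _ : ι => E) (StrongDual ℂ C₀),
      (∀ v c, Γ v (d₀ c) = Ω v c) ∧ ∀ v, Ω v = 0 → Γ v = 0 := by
  -- The test space Y is the space of all functionals to be lifted. Evaluation z ⊗ c ↦ z(c) kills
  -- the range of 1 ⊗ d₁, hence the kernel of 1 ⊗ d₀, and so factors through 1 ⊗ d₀.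
  let Z : Submodule ℂ (StrongDual ℂ C₁) :=
    LinearMap.ker (ContinuousLinearMap.precomp ℂ d₁).toLinearMap
  have hZ : IsClosed (Z : Set (StrongDual ℂ C₁)) :=
    (ContinuousLinearMap.precomp ℂ d₁).isClosed_ker
  have : CompleteSpace Z := hZ.completeSpace_coe
  obtain ⟨hclosed, hexact⟩ := h Z
  obtain ⟨g, hg⟩ := exists_tensor_functional (E := Z) (F := C₁) Z.subtypeL
  have hg0 : g.comp (ProjTensor.lmap Z d₁) = 0 := projTensor_ext fun z c => by
    rw [ContinuousLinearMap.comp_apply, lmap_pureTensor, hg]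
    exact DFunLike.congr_fun (LinearMap.mem_ker.1 z.2) c
  obtain ⟨Ψ, hΨ⟩ := exists_factor_of_isClosed_range (ProjTensor.lmap Z d₀) hclosed g
    fun t ht => by
      obtain ⟨t', rfl⟩ := (hexact t).1 ht
      exact DFunLike.congr_fun hg0 t'
  -- A bounded linear right inverse, on Z, of the dual of d₀. Its linearity keeps the lifted family
  -- multilinear and sends zeros of Ω to zeros of Γ.
  let σ : Z →L[ℂ] StrongDual ℂ C₀ := (ContinuousLinearMap.compL ℂ _ _ _ Ψ).comp pureTensorL
  have hΩZ : ∀ v, Ω v ∈ Z := fun v => LinearMap.mem_ker.2 (ContinuousLinearMap.ext (hΩ v))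
  refine ⟨σ.compContinuousMultilinearMap (Ω.codRestrict Z hΩZ), fun v c => ?_, fun v hv => ?_⟩
  · change Ψ (pureTensor _ (d₀ c)) = _
    rw [← lmap_pureTensor, hΨ, hg]
    rfl
  · change σ ⟨Ω v, hΩZ v⟩ = 0
    rw [show (⟨Ω v, hΩZ v⟩ : Z) = 0 from Subtype.ext hv, map_zero]

/-- A functional vanishing on the range of `d` is zero, if `d` stays surjective under projective
tensor products. -/
lemma eq_zero_of_surjective_lmap {C₁ C₂ : Type u} [NormedAddCommGroup C₁] [NormedSpace ℂ C₁]
    [NormedAddCommGroup C₂] [NormedSpace ℂ C₂] (d : C₂ →L[ℂ] C₁)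
    (h : ∀ (Y : Type u) [NormedAddCommGroup Y] [NormedSpace ℂ Y] [CompleteSpace Y],
      Function.Surjective (ProjTensor.lmap Y d))
    (f : StrongDual ℂ C₁) (hf : ∀ c, f (d c) = 0) : f = 0 := by
  -- The test space is the scalar field, lifted to the universe over which Y ranges.
  obtain ⟨g, hg⟩ := exists_tensor_functional (E := ULift.{u} ℂ) (F := C₁)
    ((ContinuousLinearMap.toSpanSingleton ℂ f).comp
      (ContinuousLinearEquiv.ulift : ULift.{u} ℂ ≃L[ℂ] ℂ).toContinuousLinearMap)
  have hg0 : g.comp (ProjTensor.lmap (ULift.{u} ℂ) d) = 0 := projTensor_ext fun z c => by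
    rw [ContinuousLinearMap.comp_apply, lmap_pureTensor, hg]
    simp [hf]
  ext c
  obtain ⟨t, ht⟩ := h (ULift.{u} ℂ) (pureTensor ⟨1⟩ c)
  have := DFunLike.congr_fun hg0 t
  rw [ContinuousLinearMap.comp_apply, ht, hg] at this
  have h1 : (⟨1⟩ : ULift.{u} ℂ) ≠ 0 := fun h => one_ne_zero (congrArg ULift.down h)
  simpa [h1] using this

end Splitting

/-! ### Consequences of strong H-unitality for the dual bar complex. -/

section HUnital

variable {A : Type u} [NonUnitalNormedRing A] [NormedSpace ℂ A]
  [IsScalarTower ℂ A A] [SMulCommClass ℂ A A]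

lemma StronglyHUnital.eq_zero (h : StronglyHUnital A)
    (f : StrongDual ℂ (Chains A 0)) (hf : ∀ c, f (barDiff A 0 c) = 0) : f = 0 :=
  eq_zero_of_surjective_lmap (barDiff A 0) (fun Y => (h Y).1) f hf

lemma StronglyHUnital.exists_lift (h : StronglyHUnital A) (n : ℕ)
    {E : Type*} [NormedAddCommGroup E] [NormedSpace ℂ E] {ι : Type*} [Finite ι]
    (Ω : ContinuousMultilinearMap ℂ (fun _ : ι => E) (StrongDual ℂ (Chains A (n + 1))))
    (hΩ : ∀ v c, Ω v (barDiff A (n + 1) c) = 0) :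
    ∃ Γ : ContinuousMultilinearMap ℂ (fun _ : ι => E) (StrongDual ℂ (Chains A n)),
      (∀ v c, Γ v (barDiff A n c) = Ω v c) ∧ ∀ v, Ω v = 0 → Γ v = 0 := by
  refine exists_lift_multilinear (barDiff A (n + 1)) (barDiff A n) (fun Y => ⟨?_, (h Y).2 n⟩) Ω hΩ
  -- The range is closed: it is everything at the bottom, and the kernel of the next differential
  -- above.
  cases n with
  | zero =>
    rw [(h Y).1.range_eq]
    exact isClosed_univ
  | succ n =>
    have : Set.range (ProjTensor.lmap Y (barDiff A (n + 1))) =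
        ProjTensor.lmap Y (barDiff A n) ⁻¹' {0} := by
      ext t
      exact ((h Y).2 n t).symm
    rw [this]
    exact isClosed_singleton.preimage (ContinuousLinearMap.continuous _)

end HUnital

/-! ### Extension of cocycles from a strongly H-unital ideal -/

section MultilinearComp

variable {V W : Type*} [NormedAddCommGroup V] [NormedSpace ℂ V]
  [NormedAddCommGroup W] [NormedSpace ℂ W]

/-- Precomposition of a bounded multilinear functional with a continuous map of tuples which is
linear in each variable separately. -/
lemma exists_cochain_comp {n m : ℕ} (f : Cochain W n) (φ : (Fin (m + 1) → V) → Fin (n + 1) → W)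
    (hφ : Continuous φ)
    (h : ∀ (a : Fin (m + 1) → V) (k : Fin (m + 1)), ∃ (k' : Fin (n + 1)) (L : V →ₗ[ℂ] W), ∀ x,
      φ (Function.update a k x) = Function.update (φ a) k' (L x)) :
    ∃ g : Cochain V m, ∀ x, g x = f (φ x) :=
  ⟨{ toFun := fun x => f (φ x)
     map_update_add' := by
      intro inst a k x y
      obtain rfl : inst = instDecidableEqFin _ := Subsingleton.elim _ _
      obtain ⟨k', L, h⟩ := h a k
      simp only [h, map_add, ContinuousMultilinearMap.map_update_add]
     map_update_smul' := by
      intro inst a k c x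
      obtain rfl : inst = instDecidableEqFin _ := Subsingleton.elim _ _
      obtain ⟨k', L, h⟩ := h a k
      simp only [h, map_smul, ContinuousMultilinearMap.map_update_smul]
     cont := f.cont.comp hφ }, fun _ => rfl⟩

end MultilinearComp

section Coface

variable {W : Type*} [NonUnitalNormedRing W] [NormedSpace ℂ W]
  [IsScalarTower ℂ W W] [SMulCommClass ℂ W W]

lemma continuous_face {n : ℕ} (i : ℕ) : Continuous (face (W := W) (n := n) i) := by
  refine continuous_pi fun j => ?_
  by_cases h : i < n + 1
  · simp only [face, h, dif_pos, innerFaceFun]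
    split_ifs <;> fun_prop
  · simp only [face, h, dif_neg, not_false_eq_true, lastFaceFun]
    split_ifs <;> fun_prop

lemma exists_cochain_face {n : ℕ} (f : Cochain W n) (i : ℕ) :
    ∃ g : Cochain W (n + 1), ∀ x, g x = f (face i x) := by
  refine exists_cochain_comp f (face i) (continuous_face i) fun a k => ?_
  by_cases h : i < n + 1
  · simpa only [face, h, dif_pos] using innerFaceFun_update W ⟨i, h⟩ a k
  · simpa only [face, h, dif_neg, not_false_eq_true] using lastFaceFun_update W a k

lemma exists_cochain_coface {n : ℕ} (f : Cochain W n) :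
    ∃ g : Cochain W (n + 1), ∀ x, g x = coface f x := by
  choose g hg using exists_cochain_face f
  refine ⟨∑ i ∈ Finset.range (n + 2), (-1 : ℂ) ^ i • g i, fun x => ?_⟩
  simp [coface, hg]

lemma coface_sub {n : ℕ} (f g : (Fin (n + 1) → W) → ℂ) (x : Fin (n + 2) → W) :
    coface (fun y => f y - g y) x = coface f x - coface g x := by
  simp only [coface, smul_sub, Finset.sum_sub_distrib]

end Coface

/-- A Banach algebra `A` embedded in `W` as a complemented two-sided ideal. -/
structure ComplementedIdeal (A W : Type*) [NonUnitalNormedRing A] [NormedSpace ℂ A]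
    [NonUnitalNormedRing W] [NormedSpace ℂ W] where
  /-- The inclusion. -/
  incl : A →L[ℂ] W
  /-- The projection. -/
  proj : W →L[ℂ] A
  proj_incl : ∀ a, proj (incl a) = a
  incl_mul : ∀ a b, incl (a * b) = incl a * incl b
  mul_mem : ∀ w a, w * incl a ∈ Set.range incl
  mem_mul : ∀ a w, incl a * w ∈ Set.range incl

/-! ### Cutting tuples into an ideal part and a free part. -/

section Glue

variable {W : Type*}

/-- The concatenation of two tuples. -/
def glue {N q k : ℕ} [Zero W] (a : Fin q → W) (v : Fin k → W) : Fin N → W := fun l =>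
  if h : (l : ℕ) < q then a ⟨l, h⟩ else if h' : (l : ℕ) - q < k then v ⟨l - q, h'⟩ else 0

/-- The first `q` entries of a tuple. -/
def headPart {N q k : ℕ} (h : q + k = N) (x : Fin N → W) : Fin q → W := fun j => x ⟨j, by omega⟩

/-- The last `k` entries of a tuple. -/
def tailPart {N q k : ℕ} (h : q + k = N) (x : Fin N → W) : Fin k → W :=
  fun j => x ⟨q + j, by omega⟩

variable [Zero W]

lemma headPart_glue {N q k : ℕ} (h : q + k = N) (a : Fin q → W) (v : Fin k → W) :
    headPart h (glue a v) = a := by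
  ext j; simp [headPart, glue]

lemma tailPart_glue {N q k : ℕ} (h : q + k = N) (a : Fin q → W) (v : Fin k → W) :
    tailPart h (glue a v) = v := by
  ext j; simp [tailPart, glue]

lemma glue_headPart_tailPart {N q k : ℕ} (h : q + k = N) (x : Fin N → W) :
    glue (headPart h x) (tailPart h x) = x := by
  ext l
  have := l.2
  simp only [headPart, tailPart, glue]
  split_ifs with h1 h2
  · rfl
  · congr 1; ext; simp; omega
  · omega

/-- Splitting an index set of tuples into a final and an initial segment. -/
def splitEquiv {N q k : ℕ} (h : q + k = N) : Fin N ≃ Fin k ⊕ Fin q :=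
  (finCongr h.symm).trans (finSumFinEquiv.symm.trans (Equiv.sumComm _ _))

lemma splitEquiv_symm_inl {N q k : ℕ} (h : q + k = N) (j : Fin k) :
    ((splitEquiv h).symm (Sum.inl j) : ℕ) = q + j := by
  simp [splitEquiv]

lemma splitEquiv_symm_inr {N q k : ℕ} (h : q + k = N) (j : Fin q) :
    ((splitEquiv h).symm (Sum.inr j) : ℕ) = j := by
  simp [splitEquiv]

lemma sum_elim_splitEquiv {N q k : ℕ} (h : q + k = N) (a : Fin q → W) (v : Fin k → W) :
    (fun i => Sum.elim v a (splitEquiv h i)) = (glue a v : Fin N → W) := by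
  ext i
  obtain ⟨s, rfl⟩ := (splitEquiv h).symm.surjective i
  rw [Equiv.apply_symm_apply]
  cases s with
  | inl j => simp [glue, splitEquiv_symm_inl]
  | inr j => simp [glue, splitEquiv_symm_inr]

end Glue

/-! ### Releasing the entries of a cocycle from the ideal one at a time. -/

section Excision

variable {A : Type u} {W : Type*} [NonUnitalNormedRing A] [NormedSpace ℂ A]
  [IsScalarTower ℂ A A] [SMulCommClass ℂ A A] [NonUnitalNormedRing W] [NormedSpace ℂ W]
  [IsScalarTower ℂ W W] [SMulCommClass ℂ W W]

/-- The free entries become parameters of a family of functionals on bar chains. `splitEquiv` puts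
the tail first because `currySum` keeps the left summand as outer variables. -/
lemma exists_curry {N q k : ℕ} (h : q + 1 + k = N + 1) (T : A →L[ℂ] W) (ω : Cochain W N) :
    ∃ Ω : ContinuousMultilinearMap ℂ (fun _ : Fin k => W) (StrongDual ℂ (Chains A q)),
      ∀ v a, Ω v (pureChain a) = ω (glue (T ∘ a) v) := by
  let Ω₀ := (ω.domDomCongr (splitEquiv h)).currySum
  let L : ContinuousMultilinearMap ℂ (fun _ : Fin (q + 1) => W) ℂ →L[ℂ] Cochain A q :=
    ContinuousMultilinearMap.compContinuousLinearMapL fun _ => T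
  refine ⟨((dualEquiv A q).symm.toContinuousLinearMap.comp L).compContinuousMultilinearMap Ω₀,
    fun v a => ?_⟩
  change (dualEquiv A q).symm (L (Ω₀ v)) (pureChain a) = _
  rw [dualEquiv_symm_pureChain, ← sum_elim_splitEquiv h]
  rfl

lemma exists_uncurry {N r k : ℕ} (h : r + 1 + k = N + 1) (T : W →L[ℂ] A)
    (Γ : ContinuousMultilinearMap ℂ (fun _ : Fin k => W) (StrongDual ℂ (Chains A r))) :
    ∃ g : Cochain W N, ∀ x, g x = Γ (tailPart h x) (pureChain (T ∘ headPart h x)) := by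
  let L : Cochain A r →L[ℂ] ContinuousMultilinearMap ℂ (fun _ : Fin (r + 1) => W) ℂ :=
    ContinuousMultilinearMap.compContinuousLinearMapL fun _ => T
  let Γ₀ := (L.comp (dualEquiv A r).toContinuousLinearMap).compContinuousMultilinearMap Γ
  refine ⟨Γ₀.uncurrySum.domDomCongr (splitEquiv h).symm, fun x => ?_⟩
  change (dualEquiv A r) (Γ _) _ = _
  rw [dualEquiv_apply]
  have h1 : ((fun i => x ((splitEquiv h).symm i)) ∘ Sum.inl) = tailPart h x := by
    ext j
    exact congrArg x (Fin.ext (splitEquiv_symm_inl h j))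
  have h2 : ((fun i => x ((splitEquiv h).symm i)) ∘ Sum.inr) = headPart h x := by
    ext j
    exact congrArg x (Fin.ext (splitEquiv_symm_inr h j))
  rw [← h1, ← h2]
  rfl

variable (J : ComplementedIdeal A W)

lemma ComplementedIdeal.face_incl {n : ℕ} (i : ℕ) (a : Fin (n + 2) → A) :
    face i (J.incl ∘ a) = J.incl ∘ face i a := by
  ext l
  by_cases h : i < n + 1
  · simp only [face, h, dif_pos, innerFaceFun, Function.comp_apply]
    split_ifs <;> simp [J.incl_mul]
  · simp only [face, h, dif_neg, not_false_eq_true, lastFaceFun, Function.comp_apply]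
    split_ifs <;> simp [J.incl_mul]

lemma face_glue {N q k i : ℕ} (h : q + 1 + k = N + 1) (hi : i < q + 1) (a : Fin (q + 2) → W)
    (v : Fin k → W) :
    face i (glue a v : Fin (N + 2) → W) = glue (face i a) v := by
  ext l
  have hl := l.2
  obtain ⟨y, hy⟩ := exists_nat_extension a
  obtain ⟨z, hz⟩ := exists_nat_extension v
  have h1 : i < N + 1 := by omega
  simp only [face, h1, hi, dif_pos]
  simp only [innerFaceFun, glue, Fin.lt_def, Fin.ext_iff, hy, hz, Fin.val_castSucc, Fin.val_succ]
  grind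

/-- No entry of index at most s is shifted: it is unchanged or multiplied by a neighbour, on the
left in the case of the cyclic face. Hence the ideal must be two-sided. -/
lemma ComplementedIdeal.face_mem {n s i : ℕ} (hi : s ≤ i) (x : Fin (n + 2) → W)
    (hx : ∀ j : Fin _, (j : ℕ) ≤ s → x j ∈ Set.range J.incl) (j : Fin (n + 1)) (hj : (j : ℕ) ≤ s) :
    face i x j ∈ Set.range J.incl := by
  have hmul : ∀ y ∈ Set.range J.incl, ∀ w, y * w ∈ Set.range J.incl := by
    rintro _ ⟨a, rfl⟩ w
    exact J.mem_mul a w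
  have hmul' : ∀ y ∈ Set.range J.incl, ∀ w, w * y ∈ Set.range J.incl := by
    rintro _ ⟨a, rfl⟩ w
    exact J.mul_mem w a
  by_cases h : i < n + 1
  · rcases (hj.trans hi).lt_or_eq with h' | h'
    · rw [face_apply_of_lt x h j h']
      exact hx _ hj
    · rw [face_apply_of_eq x j h']
      exact hmul _ (hx _ hj) _
  · by_cases h0 : j = 0
    · subst h0
      rw [face_last_zero x (by omega)]
      exact hmul' _ (hx _ hj) _
    · rw [face_last_of_ne_zero x (by omega) j h0]
      exact hx _ hj

/-- A cochain which is a cocycle on tuples with entries `0, …, q + 1` in the ideal can be changed,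
off the ideal, to be one on tuples with entries `0, …, q` in the ideal. -/
lemma ComplementedIdeal.exists_extension_step (hA : StronglyHUnital A) {n q : ℕ} (hq : q ≤ n)
    (f : Cochain W n)
    (hf : ∀ x, (∀ j : Fin _, (j : ℕ) ≤ q + 1 → x j ∈ Set.range J.incl) → coface f x = 0) :
    ∃ f' : Cochain W n, (∀ x, (∀ j, x j ∈ Set.range J.incl) → f' x = f x) ∧
      ∀ x, (∀ j : Fin _, (j : ℕ) ≤ q → x j ∈ Set.range J.incl) → coface f' x = 0 := by
  obtain ⟨k, rfl⟩ : ∃ k, n = q + k := ⟨n - q, by omega⟩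
  have hN : q + 1 + (k + 1) = q + k + 1 + 1 := by omega
  obtain ⟨ω, hω⟩ := exists_cochain_coface f
  obtain ⟨Ω, hΩ⟩ := exists_curry hN J.incl ω
  have hω0 : ∀ x, (∀ j : Fin _, (j : ℕ) ≤ q + 1 → x j ∈ Set.range J.incl) → ω x = 0 := fun x hx => by
    rw [hω, hf x hx]
  have hcocycle : ∀ v c, Ω v (barDiff A q c) = 0 := by
    intro v
    suffices h : (Ω v).comp (barDiff A q) = 0 from fun c => DFunLike.congr_fun h c
    refine dual_ext A fun a => ?_
    -- In δδf = 0 the faces with i ≥ q + 1 keep entries 0, …, q + 1 in the ideal, where ω vanishes.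
    -- What remains is the bar differential of the head.
    have h0 := coface_coface f (glue (J.incl ∘ a) v : Fin (q + k + 1 + 2) → W)
    have hsub : ∑ i ∈ Finset.range (q + 1), (-1 : ℂ) ^ i •
        ω (face i (glue (J.incl ∘ a) v : Fin (q + k + 1 + 2) → W)) = 0 := by
      rw [← h0, coface]
      simp only [← hω]
      refine Finset.sum_subset (Finset.range_mono (by omega)) fun i _ hi => ?_
      rw [hω0, smul_zero]
      refine J.face_mem (s := q + 1) (by simpa using hi) _ fun j hj => ?_
      exact ⟨a ⟨j, by omega⟩, by simp [glue, show (j : ℕ) < q + 2 by omega]⟩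
    rw [ContinuousLinearMap.comp_apply, barDiff_pureChain, map_sum, zero_apply,
      ← hsub]
    refine Finset.sum_congr rfl fun i hi => ?_
    rw [map_smul, hΩ, face_glue hN (Finset.mem_range.1 hi), J.face_incl]
  have hx_glue : ∀ x : Fin (q + k + 2) → W, (∀ j : Fin _, (j : ℕ) ≤ q → x j ∈ Set.range J.incl) →
      ∃ c v, x = glue (J.incl ∘ c) v ∧ ω x = Ω v (pureChain c) := by
    intro x hx
    have : ∀ j : Fin (q + 1), ∃ a, J.incl a = headPart hN x j := fun j => hx _ (Nat.lt_succ_iff.1 j.2)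
    choose c hc using this
    have hxc : x = glue (J.incl ∘ c) (tailPart hN x) := by
      rw [show J.incl ∘ c = headPart hN x from funext hc, glue_headPart_tailPart]
    exact ⟨c, tailPart hN x, hxc, by rw [hΩ, ← hxc]⟩
  cases q with
  | zero =>
    -- The lowest bar differential has no nonzero functional killing its range, so the obstruction
    -- vanishes and no correction is needed.
    refine ⟨f, fun _ _ => rfl, fun x hx => ?_⟩
    obtain ⟨c, v, -, hc⟩ := hx_glue x hx
    rw [← hω, hc, hA.eq_zero (Ω v) (hcocycle v), zero_apply]
  | succ r =>
    -- This zero passes to Γ, hence to the correction g, which therefore does not change f on the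
    -- ideal.
    have hΩ0 : ∀ v, v 0 ∈ Set.range J.incl → Ω v = 0 := fun v hv => dual_ext A fun a => by
      rw [hΩ, zero_apply]
      refine hω0 _ fun j hj => ?_
      rcases hj.lt_or_eq with h | h
      · exact ⟨a ⟨j, h⟩, by simp [glue, h]⟩
      · simpa [glue, h] using hv
    obtain ⟨Γ, hΓ, hΓ0⟩ := hA.exists_lift r Ω hcocycle
    have hN' : r + 1 + (k + 1) = r + 1 + k + 1 := rfl
    obtain ⟨g, hg⟩ := exists_uncurry hN' J.proj Γ
    have hg0 : ∀ x : Fin (r + 1 + k + 1) → W, x ⟨r + 1, by omega⟩ ∈ Set.range J.incl → g x = 0 := by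
      intro x hx
      rw [hg, hΓ0 _ (hΩ0 _ hx), zero_apply]
    refine ⟨f - g, fun x hx => ?_, fun x hx => ?_⟩
    · rw [sub_apply, hg0 x (hx _), sub_zero]
    · change coface (fun y => f y - g y) x = 0
      obtain ⟨c, v, hxc, hc⟩ := hx_glue x hx
      rw [coface_sub, ← hω, hc, ← hΓ, barDiff_pureChain, map_sum, sub_eq_zero, coface]
      -- The faces with i ≥ r + 1 leave entry r + 1 in the ideal, where g vanishes, so δg is Γ
      -- applied to the bar differential of the head.
      have hsub : ∑ i ∈ Finset.range (r + 1), (-1 : ℂ) ^ i • g (face i x) =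
          ∑ i ∈ Finset.range (r + 1 + k + 2), (-1 : ℂ) ^ i • g (face i x) := by
        refine Finset.sum_subset (Finset.range_mono (by omega)) fun i _ hi => ?_
        rw [hg0, smul_zero]
        exact J.face_mem (s := r + 1) (by simpa using hi) x hx _ le_rfl
      rw [← hsub]
      refine Finset.sum_congr rfl fun i hi => ?_
      rw [map_smul, hxc, face_glue hN' (Finset.mem_range.1 hi), J.face_incl, hg, tailPart_glue,
        headPart_glue, ← Function.comp_assoc, show J.proj ∘ J.incl = id from funext J.proj_incl,
        Function.id_comp]

/-- A cocycle on a strongly H-unital complemented ideal `A` of `W` extends to a cocycle of `W` with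
coefficients in the dual of `A`. -/
lemma ComplementedIdeal.exists_extension (hA : StronglyHUnital A) {n : ℕ} (f : Cochain A n)
    (hf : ∀ a, coface f a = 0) :
    ∃ F : Cochain W n, (∀ a, F (J.incl ∘ a) = f a) ∧
      ∀ x, x 0 ∈ Set.range J.incl → coface F x = 0 := by
  -- Here s counts the released entries: s = 0 constrains all n + 2 of them, s = n + 1 only entry 0.
  have key : ∀ s, s ≤ n + 1 → ∃ F : Cochain W n, (∀ a, F (J.incl ∘ a) = f a) ∧
      ∀ x, (∀ j : Fin _, (j : ℕ) + s ≤ n + 1 → x j ∈ Set.range J.incl) → coface F x = 0 := by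
    intro s
    induction s with
    | zero =>
      intro _
      let F : Cochain W n := f.compContinuousLinearMap fun _ => J.proj
      have hF : ∀ a, F (J.incl ∘ a) = f a := fun a => by
        change f (fun i => J.proj (J.incl (a i))) = f a
        simp only [J.proj_incl]
      refine ⟨F, hF, fun x hx => ?_⟩
      have : ∀ j, ∃ a, J.incl a = x j := fun j => hx j (by omega)
      choose a ha using this
      rw [show x = J.incl ∘ a from (funext ha).symm, ← hf a]
      simp only [coface, J.face_incl, hF]
    | succ s ih =>
      intro hs
      obtain ⟨F, hF, hF'⟩ := ih (by omega)
      obtain ⟨F', h, h'⟩ := J.exists_extension_step hA (n := n) (q := n - s) (by omega) F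
        fun x hx => hF' x fun j hj => hx j (by omega)
      exact ⟨F', fun a => (h _ fun j => ⟨a j, rfl⟩).trans (hF a), fun x hx =>
        h' x fun j hj => hx j (by omega)⟩
  obtain ⟨F, hF, hF'⟩ := key (n + 1) le_rfl
  refine ⟨F, hF, fun x hx => hF' x fun j hj => ?_⟩
  obtain rfl : j = 0 := Fin.ext (show (j : ℕ) = 0 by omega)
  exact hx

end Excision

/-! ### Vanishing of cocycles by amplification -/

section Limits

variable {W : Type*} [NormedAddCommGroup W] [NormedSpace ℂ W]

/-- A uniformly bounded sequence of multilinear functionals has a limit along an ultrafilter. -/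
lemma exists_ultrafilter_limit {n : ℕ} (U : Ultrafilter ℕ) (g : ℕ → Cochain W n) (C : ℝ)
    (hg : ∀ N x, ‖g N x‖ ≤ C * ∏ i, ‖x i‖) :
    ∃ G : Cochain W n, ∀ x, Filter.Tendsto (fun N => g N x) U (nhds (G x)) := by
  have hlim : ∀ x, ∃ z : ℂ, Filter.Tendsto (fun N => g N x) U (nhds z) := fun x => by
    obtain ⟨z, -, hz⟩ := (isCompact_closedBall (0 : ℂ) (C * ∏ i, ‖x i‖)).ultrafilter_le_nhds
      (U.map fun N => g N x) (by
        rw [Filter.le_principal_iff]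
        exact Filter.Eventually.of_forall (f := (U : Filter ℕ)) fun N => by simpa using hg N x)
    exact ⟨z, hz⟩
  choose G hG using hlim
  let G₀ : MultilinearMap ℂ (fun _ : Fin (n + 1) => W) ℂ :=
    { toFun := G
      map_update_add' := by
        intro inst a k x y
        refine tendsto_nhds_unique (hG _) ?_
        simp only [ContinuousMultilinearMap.map_update_add]
        exact (hG _).add (hG _)
      map_update_smul' := by
        intro inst a k c x
        refine tendsto_nhds_unique (hG _) ?_
        simp only [ContinuousMultilinearMap.map_update_smul]
        exact (hG _).const_smul c }
  refine ⟨G₀.mkContinuous C fun x => ?_, hG⟩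
  exact le_of_tendsto (hG x).norm (Filter.Eventually.of_forall fun N => hg N x)

end Limits

/-! ### Amplification homotopies and averaging. -/

section Amplification

variable {A W : Type*} [NonUnitalNormedRing A] [NormedSpace ℂ A] [NormedRing W]
  [NormedAlgebra ℂ W]

/-- Elements `Sₖ`, `Rₖ` of `W` with `Rₖ Sₗ = δₖₗ` whose finite amplifications
`w ↦ ∑_{k < N} Sₖ w Rₖ` are contractive. -/
structure Amplifier (W : Type*) [NormedRing W] where
  /-- The embeddings. -/
  S : ℕ → W
  /-- The projections. -/
  R : ℕ → W
  R_mul_S : ∀ k l, R k * S l = if k = l then 1 else 0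
  norm_S_le : ∀ k, ‖S k‖ ≤ 1
  norm_R_le : ∀ k, ‖R k‖ ≤ 1
  norm_sum_le : ∀ N w, ‖∑ k ∈ Finset.range N, S k * w * R k‖ ≤ ‖w‖

namespace Amplifier

variable (s : Amplifier W)

/-- The `N`-fold amplification `w ↦ ∑_{k < N} Sₖ w Rₖ`. -/
def amp (N : ℕ) : W →ₗ[ℂ] W :=
  ∑ k ∈ Finset.range N, (LinearMap.mulRight ℂ (s.R k)).comp (LinearMap.mulLeft ℂ (s.S k))

lemma amp_apply (N : ℕ) (w : W) : s.amp N w = ∑ k ∈ Finset.range N, s.S k * w * s.R k := by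
  simp [amp]

lemma norm_amp_le (N : ℕ) (w : W) : ‖s.amp N w‖ ≤ ‖w‖ := by
  rw [amp_apply]
  exact s.norm_sum_le N w

lemma continuous_amp (N : ℕ) : Continuous (s.amp N) := by
  have : (s.amp N : W → W) = fun w => ∑ k ∈ Finset.range N, s.S k * w * s.R k :=
    funext (s.amp_apply N)
  rw [this]
  fun_prop

/-- With `amp_mul_S`, this gives the intertwining relations needed by `sum_insertAt_face`. -/
lemma R_mul_amp {N k : ℕ} (hk : k < N) (w : W) : s.R k * s.amp N w = w * s.R k := by
  rw [amp_apply, Finset.mul_sum, Finset.sum_eq_single k]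
  · rw [mul_assoc, ← mul_assoc, s.R_mul_S, if_pos rfl, one_mul]
  · intro l _ hl
    rw [mul_assoc, ← mul_assoc, s.R_mul_S, if_neg hl.symm, zero_mul]
  · intro h
    exact absurd (Finset.mem_range.2 hk) h

lemma amp_mul_S {N k : ℕ} (hk : k < N) (w : W) : s.amp N w * s.S k = s.S k * w := by
  rw [amp_apply, Finset.sum_mul, Finset.sum_eq_single k]
  · rw [mul_assoc, s.R_mul_S, if_pos rfl, mul_one]
  · intro l _ hl
    rw [mul_assoc, s.R_mul_S, if_neg hl, mul_zero]
  · intro h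
    exact absurd (Finset.mem_range.2 hk) h

lemma amp_mul (N : ℕ) (v w : W) : s.amp N (v * w) = s.amp N v * s.amp N w := by
  rw [s.amp_apply N v, s.amp_apply, Finset.sum_mul]
  refine Finset.sum_congr rfl fun k hk => ?_
  rw [mul_assoc _ (s.R k), s.R_mul_amp (Finset.mem_range.1 hk)]
  simp only [mul_assoc]

/-- The tuple `(x₀ Rₖ, Φ x₁, …, Φ xⱼ, Sₖ, xⱼ₊₁, …, xₙ)` with `Φ` the amplification. -/
def shuffle (N k : ℕ) {n : ℕ} (j : ℕ) : (Fin (n + 1) → W) → Fin (n + 2) → W :=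
  insertAt (fun w => w * s.R k) (s.amp N) id (s.S k) j

lemma continuous_shuffle (N k : ℕ) {n : ℕ} (j : ℕ) : Continuous (s.shuffle N k (n := n) j) := by
  refine continuous_pi fun l => ?_
  have := s.continuous_amp N
  simp only [shuffle, insertAt, id]
  split_ifs <;> fun_prop

lemma shuffle_update (N k : ℕ) {n j : ℕ} (hj : j < n + 1) (a : Fin (n + 1) → W) (i : Fin (n + 1)) :
    ∃ (i' : Fin (n + 2)) (L : W →ₗ[ℂ] W), ∀ x,
      s.shuffle N k j (Function.update a i x) = Function.update (s.shuffle N k j a) i' (L x) := by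
  by_cases h0 : i = 0
  · refine ⟨0, LinearMap.mulRight ℂ (s.R k), fun x => ?_⟩
    ext l
    simp only [shuffle, insertAt, Function.update_apply, LinearMap.mulRight_apply, id]
    grind
  · by_cases hij : (i : ℕ) ≤ j
    · refine ⟨i.castSucc, s.amp N, fun x => ?_⟩
      ext l
      simp only [shuffle, insertAt, Function.update_apply, id]
      grind
    · refine ⟨i.succ, LinearMap.id, fun x => ?_⟩
      ext l
      simp only [shuffle, insertAt, Function.update_apply, LinearMap.id_apply, id]
      grind

lemma prod_norm_shuffle_le (N k : ℕ) {n j : ℕ} (hj : j < n + 1) (x : Fin (n + 1) → W) :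
    ∏ l, ‖s.shuffle N k j x l‖ ≤ ∏ i, ‖x i‖ := by
  rw [Fin.prod_univ_succAbove _ (⟨j + 1, by omega⟩ : Fin (n + 2))]
  have h1 : s.shuffle N k j x ⟨j + 1, by omega⟩ = s.S k := by
    simp [shuffle, insertAt, Fin.ext_iff]
  rw [h1]
  refine (mul_le_of_le_one_left (Finset.prod_nonneg fun _ _ => norm_nonneg _)
    (s.norm_S_le k)).trans (Finset.prod_le_prod (fun _ _ => norm_nonneg _) fun i _ => ?_)
  have hi := i.2
  by_cases h0 : i = 0
  · subst h0
    rw [Fin.succAbove_of_castSucc_lt _ _ (by simp [Fin.lt_def])]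
    simp only [shuffle, insertAt, Fin.castSucc_zero, if_true]
    exact (norm_mul_le _ _).trans (mul_le_of_le_one_right (norm_nonneg _) (s.norm_R_le k))
  · have h0' : (i : ℕ) ≠ 0 := fun h => h0 (Fin.ext h)
    by_cases hij : (i : ℕ) ≤ j
    · rw [Fin.succAbove_of_castSucc_lt _ _ (by simp [Fin.lt_def]; omega)]
      have : s.shuffle N k j x i.castSucc = s.amp N (x i) := by
        simp [shuffle, insertAt, h0, hij, Nat.lt_succ_iff.1 hi]
      rw [this]
      exact s.norm_amp_le N _
    · rw [Fin.succAbove_of_le_castSucc _ _ (by simp [Fin.le_def]; omega)]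
      have : s.shuffle N k j x i.succ = x i := by
        have h3 : ¬ ((i : ℕ) + 1 ≤ j) := by omega
        have h4 : (i : ℕ) ≠ j := by omega
        simp [shuffle, insertAt, h3, h4]
      rw [this]

variable (J : ComplementedIdeal A W)

/-- The homotopy between `N` times a cocycle and its pullback under `N`-fold amplification. -/
lemma exists_homotopy {n : ℕ} (F : Cochain W (n + 1))
    (hF : ∀ x, x 0 ∈ Set.range J.incl → coface F x = 0) (N : ℕ) :
    ∃ g : Cochain W n, (∀ x, ‖g x‖ ≤ N * ((n + 1) * ‖F‖) * ∏ i, ‖x i‖) ∧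
      ∀ x, x 0 ∈ Set.range J.incl → coface g x = N * F x - F (s.amp N ∘ x) := by
  -- For j > n the slot of Sₖ would fall outside the tuple; the default 0 is never summed.
  have hex : ∀ k j : ℕ, ∃ g : Cochain W n, j < n + 1 → ∀ x, g x = F (s.shuffle N k j x) :=
    fun k j => by
      by_cases hj : j < n + 1
      · obtain ⟨g, hg⟩ := exists_cochain_comp F (s.shuffle N k j) (s.continuous_shuffle N k j)
          (s.shuffle_update N k hj)
        exact ⟨g, fun _ => hg⟩
      · exact ⟨0, fun h => absurd h hj⟩
  choose g hg using hex
  refine ⟨∑ k ∈ Finset.range N, ∑ j ∈ Finset.range (n + 1), (-1 : ℂ) ^ j • g k j, fun x => ?_,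
    fun x hx => ?_⟩
  · have hN : (N : ℝ) * ((n + 1) * ‖F‖) * ∏ i, ‖x i‖ =
        ∑ k ∈ Finset.range N, ∑ j ∈ Finset.range (n + 1), ‖F‖ * ∏ i, ‖x i‖ := by
      simp [mul_assoc]
    rw [hN, sum_apply]
    refine norm_sum_le_of_le _ fun k _ => ?_
    rw [sum_apply]
    refine norm_sum_le_of_le _ fun j hj => ?_
    rw [smul_apply, norm_smul, norm_pow, norm_neg, norm_one, one_pow, one_mul,
      hg k j (Finset.mem_range.1 hj)]
    exact (F.le_opNorm _).trans (mul_le_mul_of_nonneg_left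
      (s.prod_norm_shuffle_le N k (Finset.mem_range.1 hj) x) (norm_nonneg _))
  · have hk : ∀ k ∈ Finset.range N,
        coface (fun y => ∑ j ∈ Finset.range (n + 1), (-1 : ℂ) ^ j • F (s.shuffle N k j y)) x =
          F x - F (Function.update (s.amp N ∘ x) 0 (s.S k * x 0 * s.R k)) := by
      intro k hk
      have hk' := Finset.mem_range.1 hk
      -- One end of the homotopy has x₀ Rₖ Sₖ = x₀ in slot 0, giving `F x`; the other has Sₖ x₀ Rₖ
      -- there and amplified entries elsewhere.
      have := sum_insertAt_face (P := fun w => w * s.R k) (α := s.amp N) (γ := id) (U := s.S k)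
        (I := Set.range J.incl) (fun m _ b => by rw [mul_assoc, mul_assoc, s.R_mul_amp hk'])
        (fun m _ b => mul_assoc _ _ _) (s.amp_mul N) (fun _ _ => rfl) (s.amp_mul_S hk')
        (by rintro _ ⟨a, rfl⟩; exact J.mem_mul a _) F hF x hx
      refine this.trans ?_
      congr 2
      · ext l
        by_cases hl : l = 0
        · simp [hl, mul_assoc, s.R_mul_S]
        · simp [hl]
      · ext l
        by_cases hl : l = 0
        · simp [hl, mul_assoc]
        · simp [hl]
    -- Only slot 0 is expanded: the second ends for all k < N add up to the full amplification.
    have hsum : F (s.amp N ∘ x) = ∑ k ∈ Finset.range N,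
        F (Function.update (s.amp N ∘ x) 0 (s.S k * x 0 * s.R k)) := by
      have := F.toMultilinearMap.map_update_sum (Finset.range N) (0 : Fin (n + 2))
        (fun k => s.S k * x 0 * s.R k) (s.amp N ∘ x)
      rw [← s.amp_apply, show s.amp N (x 0) = (s.amp N ∘ x) 0 from rfl,
        Function.update_eq_self] at this
      exact this
    have hN : (N : ℂ) * F x - F (s.amp N ∘ x) = ∑ k ∈ Finset.range N,
        (F x - F (Function.update (s.amp N ∘ x) 0 (s.S k * x 0 * s.R k))) := by
      rw [Finset.sum_sub_distrib, ← hsum]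
      simp
    rw [hN, ← Finset.sum_congr rfl hk]
    simp only [coface, sum_apply, smul_apply, Finset.smul_sum]
    rw [Finset.sum_comm]
    refine Finset.sum_congr rfl fun k _ => Finset.sum_congr rfl fun i _ =>
      Finset.sum_congr rfl fun j hj => ?_
    rw [hg k j (Finset.mem_range.1 hj)]

lemma norm_comp_amp_le {n : ℕ} (F : Cochain W n) (N : ℕ) (x : Fin (n + 1) → W) :
    ‖F (s.amp N ∘ x)‖ ≤ ‖F‖ * ∏ i, ‖x i‖ :=
  (F.le_opNorm _).trans (mul_le_mul_of_nonneg_left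
    (Finset.prod_le_prod (fun _ _ => norm_nonneg _) fun _ _ => s.norm_amp_le N _) (norm_nonneg _))

lemma tendsto_comp_amp_div {n : ℕ} (F : Cochain W n) (x : Fin (n + 1) → W) :
    Filter.Tendsto (fun N : ℕ => (N : ℂ)⁻¹ * F (s.amp N ∘ x)) Filter.atTop (nhds 0) := by
  refine squeeze_zero_norm (a := fun N : ℕ => (N : ℝ)⁻¹ * (‖F‖ * ∏ i, ‖x i‖)) (fun N => ?_) ?_
  · rw [norm_mul, norm_inv, Complex.norm_natCast]
    exact mul_le_mul_of_nonneg_left (s.norm_comp_amp_le F N x) (by positivity)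
  · simpa using tendsto_inv_atTop_nhds_zero_nat.mul_const (‖F‖ * ∏ i, ‖x i‖)

/-- Cocycles of positive degree of an amplifiable algebra, with coefficients in the dual of an
ideal, are coboundaries. -/
lemma exists_coface_eq (s : Amplifier W) {n : ℕ} (F : Cochain W (n + 1))
    (hF : ∀ x, x 0 ∈ Set.range J.incl → coface F x = 0) :
    ∃ G : Cochain W n, ∀ x, x 0 ∈ Set.range J.incl → coface G x = F x := by
  choose g hgn hg using s.exists_homotopy J F hF
  -- The bound on `g N` grows linearly in N, so the quotients are uniformly bounded. The ultrafilter
  -- refines `atTop`, so the term `F (s.amp N ∘ x)` divided by N tends to 0 along it.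
  obtain ⟨G, hG⟩ := exists_ultrafilter_limit (Filter.hyperfilter ℕ)
    (fun N => (N : ℂ)⁻¹ • g N) ((n + 1) * ‖F‖) fun N x => by
      rw [smul_apply, norm_smul, norm_inv, Complex.norm_natCast]
      rcases eq_or_ne N 0 with rfl | hN
      · simp only [Nat.cast_zero, inv_zero, zero_mul]; positivity
      · have hN' : (N : ℝ) ≠ 0 := Nat.cast_ne_zero.2 hN
        calc (N : ℝ)⁻¹ * ‖g N x‖ ≤ (N : ℝ)⁻¹ * (N * ((n + 1) * ‖F‖) * ∏ i, ‖x i‖) := by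
              gcongr; exact hgn N x
          _ = (n + 1) * ‖F‖ * ∏ i, ‖x i‖ := by field_simp
  refine ⟨G, fun x hx => ?_⟩
  have h1 : Filter.Tendsto (fun N : ℕ => coface ((N : ℂ)⁻¹ • g N) x)
      (Filter.hyperfilter ℕ : Filter ℕ) (nhds (coface G x)) :=
    tendsto_finsetSum _ fun i _ => (hG _).const_smul _
  have h2 : Filter.Tendsto (fun N : ℕ => F x - (N : ℂ)⁻¹ * F (s.amp N ∘ x))
      (Filter.hyperfilter ℕ : Filter ℕ) (nhds (F x)) := by
    simpa using ((s.tendsto_comp_amp_div F x).mono_left Nat.hyperfilter_le_atTop).const_sub (F x)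
  refine tendsto_nhds_unique (h1.congr' ?_) h2
  -- Division by N is the convention 0⁻¹ = 0 at N = 0, which must be discarded.
  have hne : ∀ᶠ N : ℕ in (Filter.hyperfilter ℕ : Filter ℕ), N ≠ 0 :=
    Nat.hyperfilter_le_atTop (Filter.eventually_ne_atTop 0)
  filter_upwards [hne] with N hN
  have hN' : (N : ℂ) ≠ 0 := Nat.cast_ne_zero.2 hN
  have : coface ((N : ℂ)⁻¹ • g N) x = (N : ℂ)⁻¹ * coface (g N) x := by
    simp only [coface, smul_apply, Finset.mul_sum, smul_eq_mul]
    exact Finset.sum_congr rfl fun _ _ => by ring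
  rw [this, hg N x hx, mul_sub, inv_mul_cancel_left₀ hN']

/-- Bounded traces on an ideal of an amplifiable algebra vanish. -/
lemma eq_zero_of_coface_eq_zero (s : Amplifier W) (F : Cochain W 0)
    (hF : ∀ x, x 0 ∈ Set.range J.incl → coface F x = 0) (x : Fin 1 → W)
    (hx : x 0 ∈ Set.range J.incl) : F x = 0 := by
  -- By the trace property each summand Sₖ (x₀ Rₖ) has the value of x₀ Rₖ Sₖ = x₀; boundedness in N
  -- then forces zero.
  have key : ∀ N : ℕ, F (s.amp N ∘ x) = N * F x := by
    intro N
    have h := F.toMultilinearMap.map_update_sum (Finset.range N) (0 : Fin 1)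
      (fun k => s.S k * x 0 * s.R k) (s.amp N ∘ x)
    rw [← s.amp_apply, show s.amp N (x 0) = (s.amp N ∘ x) 0 from rfl,
      Function.update_eq_self] at h
    refine h.trans ?_
    rw [Finset.sum_congr rfl (g := fun _ => F x), Finset.sum_const, Finset.card_range,
      nsmul_eq_mul]
    intro k _
    have := apply_eq_of_coface_eq_zero (P := fun w => w * s.R k) (U := s.S k)
      (I := Set.range J.incl) (by rintro _ ⟨a, rfl⟩; exact J.mem_mul a _) F hF (x 0) hx
    simp only [mul_assoc, s.R_mul_S, if_true, mul_one] at this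
    have e1 : (fun _ : Fin 1 => x 0) = x := by
      ext l; rw [Subsingleton.elim l 0]
    have e2 : Function.update (s.amp N ∘ x) 0 (s.S k * x 0 * s.R k) =
        fun _ : Fin 1 => s.S k * (x 0 * s.R k) := by
      ext l; rw [Subsingleton.elim l 0]; simp [mul_assoc]
    rw [e1] at this
    change F (Function.update (s.amp N ∘ x) 0 (s.S k * x 0 * s.R k)) = F x
    rw [e2, ← this]
  refine tendsto_nhds_unique (tendsto_const_nhds.congr' ?_) (s.tendsto_comp_amp_div F x)
  filter_upwards [Filter.eventually_ne_atTop 0] with N hN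
  rw [key, inv_mul_cancel_left₀ (Nat.cast_ne_zero.2 hN)]

end Amplifier

end Amplification

/-! ### Excision and amplification combined. -/

section Triviality

variable {A : Type u} {W : Type*} [NonUnitalNormedRing A] [NormedSpace ℂ A]
  [IsScalarTower ℂ A A] [SMulCommClass ℂ A A] [NormedRing W] [NormedAlgebra ℂ W]

/-- A strongly H-unital complemented ideal of an amplifiable algebra is simplicially trivial. -/
theorem StronglyHUnital.simpliciallyTrivial (hA : StronglyHUnital A)
    (J : ComplementedIdeal A W) (s : Amplifier W) : SimpliciallyTrivial A := by
  intro n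
  suffices h : cocycles A n ≤ coboundaries A n from
    Submodule.Quotient.subsingleton_iff.2 (Submodule.submoduleOf_eq_top.2 h)
  intro f hf
  have hcocycle : ∀ a, coface (dualEquiv A n f) a = 0 := fun a => by
    have := DFunLike.congr_fun (LinearMap.mem_ker.1 hf) (pureChain a)
    simp only [coface, dualEquiv_apply]
    refine Eq.trans ?_ this
    change _ = f (hochDiff A n (pureChain a))
    rw [hochDiff_pureChain, map_sum]
    simp only [map_smul]
  obtain ⟨F, hF, hF0⟩ := J.exists_extension hA (dualEquiv A n f) hcocycle
  cases n with
  | zero =>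
    have : f = 0 := dual_ext A fun a => by
      rw [← dualEquiv_apply, ← hF, s.eq_zero_of_coface_eq_zero J F hF0 _ ⟨a 0, rfl⟩]
      rfl
    rw [this]
    exact Submodule.zero_mem _
  | succ n =>
    obtain ⟨G, hG⟩ := s.exists_coface_eq J F hF0
    let G₀ : Cochain A n := G.compContinuousLinearMap fun _ => J.incl
    refine ⟨(dualEquiv A n).symm G₀, dual_ext A fun a => ?_⟩
    change (dualEquiv A n).symm G₀ (hochDiff A n (pureChain a)) = _
    rw [hochDiff_pureChain, map_sum, ← dualEquiv_apply, ← hF, ← hG _ ⟨a 0, rfl⟩, coface]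
    refine Finset.sum_congr rfl fun i _ => ?_
    rw [map_smul, dualEquiv_symm_pureChain, J.face_incl]
    rfl

end Triviality

/-! ### Amplifications of `ℓ_p`-spaces -/

section Blocks

variable {X : Type*} [NormedAddCommGroup X] [NormedSpace ℂ X] {p : ℝ≥0∞} [Fact (1 ≤ p)]

lemma toReal_pos_of_ne_top (hp : p ≠ ∞) : 0 < p.toReal :=
  ENNReal.toReal_pos (zero_lt_one.trans_le Fact.out).ne' hp

lemma pair_injective (k : ℕ) : Function.Injective (Nat.pair k) := fun _ _ h =>
  (Nat.pair_eq_pair.1 h).2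

/-- The `k`-th block of a sequence. -/
def blockFun (hp : p ≠ ∞) (k : ℕ) : lp (fun _ : ℕ => X) p →ₗ[ℂ] lp (fun _ : ℕ => X) p where
  toFun x := ⟨fun j => x (Nat.pair k j), (memℓp_gen_iff (toReal_pos_of_ne_top hp)).2
    (((memℓp_gen_iff (toReal_pos_of_ne_top hp)).1 (lp.memℓp x)).comp_injective
      (pair_injective k))⟩
  map_add' _ _ := rfl
  map_smul' _ _ := rfl

/-- The pairing bijection ℕ × ℕ ≃ ℕ regroups the absolutely convergent sum of p-th powers by blocks.
-/
lemma hasSum_norm_blockFun (hp : p ≠ ∞) (x : lp (fun _ : ℕ => X) p) :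
    HasSum (fun k => ‖blockFun hp k x‖ ^ p.toReal) (‖x‖ ^ p.toReal) := by
  have hp' := toReal_pos_of_ne_top hp
  have h : HasSum (fun q : ℕ × ℕ => ‖x (Nat.pair q.1 q.2)‖ ^ p.toReal) (‖x‖ ^ p.toReal) :=
    (Nat.pairEquiv.hasSum_iff (f := fun n => ‖x n‖ ^ p.toReal)).2 (lp.hasSum_norm hp' x)
  exact h.prod_fiberwise fun k => lp.hasSum_norm hp' (blockFun hp k x)

lemma norm_blockFun_le (hp : p ≠ ∞) (k : ℕ) (x : lp (fun _ : ℕ => X) p) :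
    ‖blockFun hp k x‖ ≤ ‖x‖ :=
  (Real.rpow_le_rpow_iff (norm_nonneg _) (norm_nonneg _) (toReal_pos_of_ne_top hp)).1
    (le_hasSum (hasSum_norm_blockFun hp x) k fun _ _ => by positivity)

/-- The sequence with prescribed `k`-th block and all other blocks zero. -/
def unblockFun (hp : p ≠ ∞) (k : ℕ) : lp (fun _ : ℕ => X) p →ₗ[ℂ] lp (fun _ : ℕ => X) p where
  toFun x := ⟨fun n => if (Nat.unpair n).1 = k then x (Nat.unpair n).2 else 0, by
    have hp' := toReal_pos_of_ne_top hp
    refine (memℓp_gen_iff hp').2 ?_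
    rw [← (pair_injective k).summable_iff]
    · simpa [Function.comp_def] using (memℓp_gen_iff hp').1 (lp.memℓp x)
    · intro n hn
      have : (Nat.unpair n).1 ≠ k := fun h =>
        hn ⟨(Nat.unpair n).2, by rw [← h, Nat.pair_unpair]⟩
      simp [this, hp'.ne']⟩
  map_add' x y := by
    ext n
    change (if (Nat.unpair n).1 = k then x (Nat.unpair n).2 + y (Nat.unpair n).2 else 0) =
      (if (Nat.unpair n).1 = k then x (Nat.unpair n).2 else 0) +
        (if (Nat.unpair n).1 = k then y (Nat.unpair n).2 else 0)
    split_ifs <;> simp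
  map_smul' c x := by
    ext n
    change (if (Nat.unpair n).1 = k then c • x (Nat.unpair n).2 else 0) =
      c • (if (Nat.unpair n).1 = k then x (Nat.unpair n).2 else 0)
    split_ifs <;> simp

lemma blockFun_unblockFun (hp : p ≠ ∞) (k l : ℕ) (x : lp (fun _ : ℕ => X) p) :
    blockFun hp k (unblockFun hp l x) = if k = l then x else 0 := by
  ext j
  change (if (Nat.unpair (Nat.pair k j)).1 = l then x (Nat.unpair (Nat.pair k j)).2 else 0) = _
  by_cases h : k = l <;> simp [h]

/-- Disjoint blocks add in p-th powers. This ℓ_p-additivity makes all finite amplifications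
contractive, uniformly in their number of blocks. -/
lemma norm_sum_unblockFun (hp : p ≠ ∞) (s : Finset ℕ) (x : ℕ → lp (fun _ : ℕ => X) p) :
    ‖∑ k ∈ s, unblockFun hp k (x k)‖ ^ p.toReal = ∑ k ∈ s, ‖x k‖ ^ p.toReal := by
  have hp' := toReal_pos_of_ne_top hp
  refine (hasSum_norm_blockFun hp _).unique ?_
  have : ∀ l, blockFun hp l (∑ k ∈ s, unblockFun hp k (x k)) = if l ∈ s then x l else 0 := by
    intro l
    simp [map_sum, blockFun_unblockFun]
  simp only [this]
  have h := hasSum_sum_of_ne_finset_zero (s := s) (L := SummationFilter.unconditional ℕ)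
    (f := fun l => ‖if l ∈ s then x l else 0‖ ^ p.toReal) fun l hl => by simp [hl, hp'.ne']
  rwa [Finset.sum_congr rfl (g := fun k => ‖x k‖ ^ p.toReal) fun k hk => by rw [if_pos hk]] at h

/-- The projection of `ℓ_p(X)` to its `k`-th block. -/
def block (hp : p ≠ ∞) (k : ℕ) : lp (fun _ : ℕ => X) p →L[ℂ] lp (fun _ : ℕ => X) p :=
  (blockFun hp k).mkContinuous 1 fun x => by rw [one_mul]; exact norm_blockFun_le hp k x

/-- The embedding of `ℓ_p(X)` in itself as the `k`-th block. -/
def unblock (hp : p ≠ ∞) (k : ℕ) : lp (fun _ : ℕ => X) p →L[ℂ] lp (fun _ : ℕ => X) p :=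
  (unblockFun hp k).mkContinuous 1 fun x => by
    rw [one_mul, ← Real.rpow_le_rpow_iff (norm_nonneg _) (norm_nonneg _)
      (toReal_pos_of_ne_top hp)]
    simpa using (norm_sum_unblockFun hp {k} fun _ => x).le

variable (X) in
/-- The block structure of `ℓ_p(X)`. -/
def lpAmplifier (hp : p ≠ ∞) :
    Amplifier (lp (fun _ : ℕ => X) p →L[ℂ] lp (fun _ : ℕ => X) p) where
  S := unblock hp
  R := block hp
  R_mul_S k l := by
    ext1 x
    refine (blockFun_unblockFun hp k l x).trans ?_
    split_ifs <;> rfl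
  norm_S_le k := LinearMap.mkContinuous_norm_le _ zero_le_one _
  norm_R_le k := LinearMap.mkContinuous_norm_le _ zero_le_one _
  norm_sum_le N T := by
    refine ContinuousLinearMap.opNorm_le_bound _ (norm_nonneg _) fun x => ?_
    have hp' := toReal_pos_of_ne_top hp
    have e : (∑ k ∈ Finset.range N, unblock hp k * T * block hp k :
          lp (fun _ : ℕ => X) p →L[ℂ] lp (fun _ : ℕ => X) p) x =
        ∑ k ∈ Finset.range N, unblockFun hp k (T (blockFun hp k x)) := by
      rw [sum_apply]; rfl
    rw [e, ← Real.rpow_le_rpow_iff (norm_nonneg _) (by positivity) hp', norm_sum_unblockFun]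
    calc ∑ k ∈ Finset.range N, ‖T (blockFun hp k x)‖ ^ p.toReal
        ≤ ∑ k ∈ Finset.range N, ‖T‖ ^ p.toReal * ‖blockFun hp k x‖ ^ p.toReal := by
          refine Finset.sum_le_sum fun k _ => ?_
          rw [← Real.mul_rpow (norm_nonneg _) (norm_nonneg _)]
          exact Real.rpow_le_rpow (norm_nonneg _) (T.le_opNorm _) hp'.le
      _ = ‖T‖ ^ p.toReal * ∑ k ∈ Finset.range N, ‖blockFun hp k x‖ ^ p.toReal := by
          rw [Finset.mul_sum]
      _ ≤ ‖T‖ ^ p.toReal * ‖x‖ ^ p.toReal := by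
          gcongr
          exact sum_le_hasSum _ (fun _ _ => by positivity) (hasSum_norm_blockFun hp x)
      _ = (‖T‖ * ‖x‖) ^ p.toReal := (Real.mul_rpow (norm_nonneg _) (norm_nonneg _)).symm

end Blocks

/-! ### The multiplier algebra of pairs of operators with approximable difference -/

section Pairs

variable (E : Type*) [NormedAddCommGroup E] [NormedSpace ℂ E]

variable {E} in
lemma mul_mem_approximable {a : E →L[ℂ] E} (ha : a ∈ approximable E) (b : E →L[ℂ] E) :
    b * a ∈ approximable E := by
  refine map_mem_closure (f := fun c => b * c) (by fun_prop) ha fun c hc => ?_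
  have : FiniteDimensional ℂ (LinearMap.range c.toLinearMap) := hc
  change FiniteDimensional ℂ (LinearMap.range (b.toLinearMap ∘ₗ c.toLinearMap))
  rw [LinearMap.range_comp]
  infer_instance

variable {E} in
lemma mem_mul_approximable {a : E →L[ℂ] E} (ha : a ∈ approximable E) (b : E →L[ℂ] E) :
    a * b ∈ approximable E := by
  refine map_mem_closure (f := fun c => c * b) (by fun_prop) ha fun c hc => ?_
  have : FiniteDimensional ℂ (LinearMap.range c.toLinearMap) := hc
  exact Submodule.finiteDimensional_of_le
    (LinearMap.range_comp_le_range b.toLinearMap c.toLinearMap)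

/-- The pairs of bounded operators with approximable difference. -/
def approxPairs : Subalgebra ℂ ((E →L[ℂ] E) × (E →L[ℂ] E)) where
  carrier := {w | w.1 - w.2 ∈ approximable E}
  mul_mem' := by
    intro v w hv hw
    have : (v * w).1 - (v * w).2 = (v.1 - v.2) * w.1 + v.2 * (w.1 - w.2) := by
      simp only [Prod.fst_mul, Prod.snd_mul]
      noncomm_ring
    change (v * w).1 - (v * w).2 ∈ approximable E
    rw [this]
    exact add_mem (mem_mul_approximable hv _) (mul_mem_approximable hw _)
  add_mem' := by
    intro v w hv hw
    have : (v + w).1 - (v + w).2 = (v.1 - v.2) + (w.1 - w.2) := by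
      simp only [Prod.fst_add, Prod.snd_add]
      abel
    change (v + w).1 - (v + w).2 ∈ approximable E
    rw [this]
    exact add_mem hv hw
  algebraMap_mem' c := by
    change algebraMap ℂ (E →L[ℂ] E) c - algebraMap ℂ (E →L[ℂ] E) c ∈ approximable E
    rw [sub_self]
    exact zero_mem _

/-- The approximable operators `a` as the complemented ideal of the pairs `(a, 0)`. -/
def approxIdeal : ComplementedIdeal (approximable E) (approxPairs E) where
  incl := LinearMap.mkContinuous
    { toFun := fun a => ⟨((a : E →L[ℂ] E), 0), by
        change (a : E →L[ℂ] E) - 0 ∈ approximable E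
        rw [sub_zero]; exact a.2⟩
      map_add' := fun a b => Subtype.ext (Prod.ext rfl (add_zero _).symm)
      map_smul' := fun c a => Subtype.ext (Prod.ext rfl (smul_zero _).symm) } 1 fun a => by
    rw [one_mul]
    change max ‖(a : E →L[ℂ] E)‖ ‖(0 : E →L[ℂ] E)‖ ≤ ‖(a : E →L[ℂ] E)‖
    simp
  -- The complement is the diagonal. The projection is linear but need not be multiplicative, which
  -- suffices for excision; 2 comes from the triangle inequality.
  proj := LinearMap.mkContinuous
    { toFun := fun w => ⟨w.1.1 - w.1.2, w.2⟩
      map_add' := fun v w => Subtype.ext (add_sub_add_comm _ _ _ _)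
      map_smul' := fun c w => Subtype.ext (smul_sub _ _ _).symm } 2 fun w => by
    change ‖w.1.1 - w.1.2‖ ≤ 2 * max ‖w.1.1‖ ‖w.1.2‖
    refine (norm_sub_le _ _).trans ?_
    linarith [le_max_left ‖w.1.1‖ ‖w.1.2‖, le_max_right ‖w.1.1‖ ‖w.1.2‖]
  proj_incl a := Subtype.ext (sub_zero _)
  incl_mul a b := Subtype.ext (Prod.ext rfl (mul_zero _).symm)
  mul_mem w a := ⟨⟨w.1.1 * a, mul_mem_approximable a.2 _⟩,
    Subtype.ext (Prod.ext rfl (mul_zero _).symm)⟩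
  mem_mul a w := ⟨⟨a * w.1.1, mem_mul_approximable a.2 _⟩,
    Subtype.ext (Prod.ext rfl (zero_mul _).symm)⟩

variable {E} in
/-- The diagonal embedding of operators. -/
def diagPair (b : E →L[ℂ] E) : approxPairs E :=
  ⟨(b, b), by change b - b ∈ approximable E; rw [sub_self]; exact zero_mem _⟩

variable {E} in
/-- An amplification of operators amplifies pairs of operators. -/
def Amplifier.pairs (s : Amplifier (E →L[ℂ] E)) : Amplifier (approxPairs E) where
  S k := diagPair (s.S k)
  R k := diagPair (s.R k)
  R_mul_S k l := by
    refine Subtype.ext (Prod.ext ?_ ?_) <;>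
    · refine (s.R_mul_S k l).trans ?_
      split_ifs <;> rfl
  norm_S_le k := max_le (s.norm_S_le k) (s.norm_S_le k)
  norm_R_le k := max_le (s.norm_R_le k) (s.norm_R_le k)
  norm_sum_le N w := by
    have e : ((∑ k ∈ Finset.range N, diagPair (s.S k) * w * diagPair (s.R k) : approxPairs E) :
        (E →L[ℂ] E) × (E →L[ℂ] E)) = (∑ k ∈ Finset.range N, s.S k * w.1.1 * s.R k,
          ∑ k ∈ Finset.range N, s.S k * w.1.2 * s.R k) := by
      rw [AddSubmonoidClass.coe_finsetSum]
      refine Prod.ext ?_ ?_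
      · rw [Prod.fst_sum]; rfl
      · rw [Prod.snd_sum]; rfl
    change ‖((∑ k ∈ Finset.range N, diagPair (s.S k) * w * diagPair (s.R k) : approxPairs E) :
        (E →L[ℂ] E) × (E →L[ℂ] E))‖ ≤ max ‖w.1.1‖ ‖w.1.2‖
    rw [e]
    exact max_le_max (s.norm_sum_le N _) (s.norm_sum_le N _)

end Pairs

end SimplicialTriviality

end

theorem mainTheorem3 (X : Type u) [NormedAddCommGroup X] [NormedSpace ℂ X] [CompleteSpace X]
    (p : ℝ≥0∞) [Fact (1 ≤ p)] (hp : p ≠ ∞)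
    (h : SimplicialTriviality.StronglyHUnital
      (SimplicialTriviality.approximable (lp (fun _ : ℕ => X) p))) :
    SimplicialTriviality.SimpliciallyTrivial
      (SimplicialTriviality.approximable (lp (fun _ : ℕ => X) p)) :=
  h.simpliciallyTrivial (SimplicialTriviality.approxIdeal _)
    (SimplicialTriviality.lpAmplifier X hp).pairs
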